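/- Let $(w_k)_{k\ge 0}$ be i.i.d. random vectors in $\mathbb{R}^d$ with mean zero and positive definite covariance matrix $\Sigma$. Let $T:\mathbb{R}^d\to\mathbb{R}^d$ be differentiable, and suppose there are weights $\mu_1,\dots,\mu_d>0$ and $\gamma\in(0,1)$ with $\|T(x_1)-T(x_2)\|_\mu\le\gamma\|x_1-x_2\|_\mu$ for all $x_1,x_2\in\mathbb{R}^d$, where $\|x\|_\mu=(\sum_i\mu_i x_i^2)^{1/2}$. Let $x^*$ be the (unique) fixed point of $T$ and let $J$ be the Jacobian matrix of $T$ at $x^*$. For $\alpha>0$ and $x_0\in\mathbb{R}^d$ let $X^{(\alpha)}_0=x_0$, $X^{(\alpha)}_{k+1}=X^{(\alpha)}_k+\alpha\big(T(X^{(\alpha)}_k)-X^{(\alpha)}_k+w_k\big)$, and $Y^{(\alpha)}_k=(X^{(\alpha)}_k-x^*)/\sqrt{\alpha}$, so that $$Y^{(\alpha)}_{k+1}=Y^{(\alpha)}_k+\sqrt{\alpha}\,\big(T(\sqrt{\alpha}\,Y^{(\alpha)}_k+x^*)-(\sqrt{\alpha}\,Y^{(\alpha)}_k+x^*)\big)+\sqrt{\alpha}\,w_k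 .$$ Then there is a threshold $\bar\alpha>0$ such that the following hold. (1) For every $\alpha\in(0,\bar\alpha)$ there is a random vector $Y^{(\alpha)}$, whose law does not depend on $x_0$, such that for every initial point $x_0$ the sequence $(Y^{(\alpha)}_k)_k$ converges weakly to $Y^{(\alpha)}$. The law of $Y^{(\alpha)}$ is stationary for the recursion above, and $\mathbb{E}\|Y^{(\alpha)}\|_2^2<\infty$. (2) There is a random vector $Y$ such that for every sequence $(\alpha_i)$ in $(0,\bar\alpha)$ with $\alpha_i\to 0$ the sequence $(Y^{(\alpha_i)})$ converges weakly to $Y$, and $$\mathbb{E}\Big[\big(t^\top\Sigma t-2i\,t^\top(J-I)Y\big)e^{i t^\top Y}\Big]=0\qquad\text{for all }t\in\mathbb{R}^d, \tag{$*$}$$ where all the expectations are well defined (the integrands are integrable). The Lyapunov equation $(J-I)S+S(J-I)^\top+\Sigma=0$ has exactly one solution $S=\Sigma_Y$ among the real $d\times d$ matrices, and $\Sigma_Y$ is positive definite. If moreover $(*)$ has a unique solution in terms of the distribution of $Y$ (exactly one probability measure on $\mathbb{R}^d$ for which the integrands are integrable and $(*)$ holds), then $Y$ has the multivariate normal distribution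 with mean zero and covariance matrix $\Sigma_Y$. -/

import Mathlib

open MeasureTheory ProbabilityTheory Filter Topology
open scoped Matrix

noncomputable section

/-- The weighted `ℓ²` norm `‖x‖_μ = (∑ i, μ i * (x i)²)^(1/2)` on `ℝ^d`. -/
def weightedNorm {d : ℕ} (μ : Fin d → ℝ) (x : EuclideanSpace ℝ (Fin d)) : ℝ :=
  √(∑ i, μ i * x i ^ 2)

/-- The Jacobian matrix of `T` at `x`: the entry `(i, j)` is the derivative of the `i`-th component
in the direction of the `j`-th coordinate. -/
def jacobianMatrix {d : ℕ} (T : EuclideanSpace ℝ (Fin d) → EuclideanSpace ℝ (Fin d))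
    (x : EuclideanSpace ℝ (Fin d)) : Matrix (Fin d) (Fin d) ℝ :=
  Matrix.of fun i j => fderiv ℝ T x (EuclideanSpace.single j 1) i

/-- The constant-stepsize stochastic approximation iterates
`X (k+1) = X k + α (F (X k) + w k)` started at `X 0 = x₀`. -/
def saIterate {d : ℕ} {Ω : Type*} (F : EuclideanSpace ℝ (Fin d) → EuclideanSpace ℝ (Fin d))
    (w : ℕ → Ω → EuclideanSpace ℝ (Fin d)) (x₀ : EuclideanSpace ℝ (Fin d)) (α : ℝ) :
    ℕ → Ω → EuclideanSpace ℝ (Fin d)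
  | 0, _ => x₀
  | k + 1, ω => saIterate F w x₀ α k ω + α • (F (saIterate F w x₀ α k ω) + w k ω)

/-- The centered scaled iterates `Y k = (X k - x*) / √α` of the stochastic approximation algorithm
with `F x = T x - x`. -/
def scaledIterate {d : ℕ} {Ω : Type*} (T : EuclideanSpace ℝ (Fin d) → EuclideanSpace ℝ (Fin d))
    (xs : EuclideanSpace ℝ (Fin d)) (w : ℕ → Ω → EuclideanSpace ℝ (Fin d))
    (x₀ : EuclideanSpace ℝ (Fin d)) (α : ℝ) (k : ℕ) (ω : Ω) : EuclideanSpace ℝ (Fin d) :=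
  (√α)⁻¹ • (saIterate (fun x => T x - x) w x₀ α k ω - xs)

/-- One step of the recursion of the centered scaled iterates, from the state `y` with noise `v`. -/
def scaledStep {d : ℕ} (T : EuclideanSpace ℝ (Fin d) → EuclideanSpace ℝ (Fin d))
    (xs : EuclideanSpace ℝ (Fin d)) (α : ℝ) (y v : EuclideanSpace ℝ (Fin d)) :
    EuclideanSpace ℝ (Fin d) :=
  y + √α • (T (√α • y + xs) - (√α • y + xs)) + √α • v

/-- The centered scaled iterates follow the recursion given by `scaledStep`. -/
theorem scaledIterate_succ {d : ℕ} {Ω : Type*}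
    (T : EuclideanSpace ℝ (Fin d) → EuclideanSpace ℝ (Fin d))
    (xs : EuclideanSpace ℝ (Fin d)) (w : ℕ → Ω → EuclideanSpace ℝ (Fin d))
    (x₀ : EuclideanSpace ℝ (Fin d)) {α : ℝ} (hα : 0 < α) (k : ℕ) (ω : Ω) :
    scaledIterate T xs w x₀ α (k + 1) ω =
      scaledStep T xs α (scaledIterate T xs w x₀ α k ω) (w k ω) := by
  have h : √α ≠ 0 := (Real.sqrt_pos.2 hα).ne'
  have h2 : (√α)⁻¹ * α = √α := by
    rw [inv_mul_eq_iff_eq_mul₀ h, Real.mul_self_sqrt hα.le]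
  simp only [scaledIterate, scaledStep, saIterate, smul_inv_smul₀ h, sub_add_cancel]
  rw [add_sub_right_comm, smul_add, smul_smul, h2, smul_add, add_assoc]

/-- `ρ` is a stationary law of the recursion of the centered scaled iterates with noise law `ν`:
if `Y ∼ ρ` and `v ∼ ν` are independent, then the next state again has law `ρ`. -/
def IsStationaryLaw {d : ℕ} (T : EuclideanSpace ℝ (Fin d) → EuclideanSpace ℝ (Fin d))
    (xs : EuclideanSpace ℝ (Fin d)) (α : ℝ) (ν ρ : Measure (EuclideanSpace ℝ (Fin d))) : Prop :=
  (ρ.prod ν).map (fun p => scaledStep T xs α p.1 p.2) = ρ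

/-- The integrand `(tᵀ C t - 2 i tᵀ A y) exp (i tᵀ y)`. -/
def limitIntegrand {d : ℕ} (C A : Matrix (Fin d) (Fin d) ℝ) (t y : EuclideanSpace ℝ (Fin d)) : ℂ :=
  (((t.ofLp ⬝ᵥ (C *ᵥ t.ofLp) : ℝ) : ℂ)
      - 2 * Complex.I * ((t.ofLp ⬝ᵥ (A *ᵥ y.ofLp) : ℝ) : ℂ))
    * Complex.exp (Complex.I * ((t.ofLp ⬝ᵥ y.ofLp : ℝ) : ℂ))

/-- A random vector `Y` with law `ρ` satisfies
`E[(tᵀ C t - 2 i tᵀ A Y) exp (i tᵀ Y)] = 0` for all `t`, all these expectations being well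
defined. -/
def SolvesLimitEquation {d : ℕ} (C A : Matrix (Fin d) (Fin d) ℝ)
    (ρ : Measure (EuclideanSpace ℝ (Fin d))) : Prop :=
  ∀ t : EuclideanSpace ℝ (Fin d),
    Integrable (limitIntegrand C A t) ρ ∧ ∫ y, limitIntegrand C A t y ∂ρ = 0

/-- The matrix `S` solves the Lyapunov equation `A S + S Aᵀ + C = 0`. -/
def SolvesLyapunov {d : ℕ} (A C S : Matrix (Fin d) (Fin d) ℝ) : Prop :=
  A * S + S * Aᵀ + C = 0

end

/-! Let `D` be the diagonal scaling by the square roots of the weights, so that the weighted norm is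
`‖D x‖`. For `α < 1` the drift `Φ_α` of the scaled recursion contracts this norm by `1 - α (1 - γ)`.
Driving two copies by the same noise, the Markov operator shrinks Lipschitz constants by this
factor, so its iterates on a bounded Lipschitz function tend to a constant independent of the
starting point. The second moments of the laws started at `0` stay below a constant independent of
`α`; tightness then gives a law with these limiting integrals, which is stationary and attracts
every start (`exists_stationary_law`).

The small-stepsize limit is found with characteristic functions. With `B_α t = t + α (Jᵀ - I) t`,
stationarity, differentiability of `T` at the fixed point and the expansion of the noise
characteristic function give `φ_α(t) = φ_α(B_α t) (1 - α tᵀΣt / 2)` up to an error `α ‖t‖ o(1)`. By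
the Lyapunov equation, `exp (-tᵀSt / 2)` satisfies the same approximate recursion
(`inner_adjointStep`). Since `B_α` contracts the dual norm `‖D⁻¹ t‖` by `1 - α (1 - γ)`, the errors
along the orbit of `t` sum to `o(1) ‖D⁻¹ t‖ / (1 - γ)`: the factor `α` cancels
(`le_mul_of_le_comp_add`, `tendsto_charFun_stationary`). Lévy's continuity theorem thus identifies
the limit as Gaussian with covariance `S`, and differentiating its characteristic function gives the
equation `(*)`. -/

set_option linter.unusedSectionVars false

/-! ### Contractive Markov steps and their stationary laws -/

section MarkovStep

variable {E : Type*} [NormedAddCommGroup E] [InnerProductSpace ℝ E] [FiniteDimensional ℝ E]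
  [MeasurableSpace E] [BorelSpace E]

/-- The law of `Φ y + s • v` for independent `y ∼ m` and `v ∼ ν`. -/
noncomputable def stepLaw (Φ : E → E) (s : ℝ) (ν m : Measure E) : Measure E :=
  (m.prod ν).map fun p => Φ p.1 + s • p.2

/-- The Markov operator `f ↦ (y ↦ E[f (Φ y + s • v)])`, where `v ∼ ν`. -/
noncomputable def stepOp (Φ : E → E) (s : ℝ) (ν : Measure E) (f : E → ℝ) (y : E) : ℝ :=
  ∫ v, f (Φ y + s • v) ∂ν

lemma measurable_step {Φ : E → E} (hΦ : Continuous Φ) (s : ℝ) :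
    Measurable fun p : E × E => Φ p.1 + s • p.2 :=
  ((hΦ.comp continuous_fst).add (continuous_snd.const_smul s)).measurable

lemma isProbabilityMeasure_stepLaw {Φ : E → E} (hΦ : Continuous Φ) (s : ℝ) (ν m : Measure E)
    [IsProbabilityMeasure ν] [IsProbabilityMeasure m] : IsProbabilityMeasure (stepLaw Φ s ν m) :=
  Measure.isProbabilityMeasure_map (measurable_step hΦ s).aemeasurable

lemma isProbabilityMeasure_iterate_stepLaw {Φ : E → E} (hΦ : Continuous Φ) (s : ℝ)
    (ν m : Measure E) [IsProbabilityMeasure ν] [IsProbabilityMeasure m] (k : ℕ) :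
    IsProbabilityMeasure ((stepLaw Φ s ν)^[k] m) := by
  induction k with
  | zero => simpa
  | succ k ih =>
    rw [Function.iterate_succ_apply']
    exact isProbabilityMeasure_stepLaw hΦ s ν _

lemma continuous_stepOp {Φ : E → E} (hΦ : Continuous Φ) (s : ℝ) (ν : Measure E)
    [IsProbabilityMeasure ν] {f : E → ℝ} (hf : Continuous f) {M : ℝ} (hM : ∀ x, |f x| ≤ M) :
    Continuous (stepOp Φ s ν f) := by
  refine continuous_of_dominated (F := fun y v => f (Φ y + s • v)) (bound := fun _ => M) ?_ ?_
    (integrable_const M) ?_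
  · exact fun y => (hf.comp (by fun_prop : Continuous fun v => Φ y + s • v)).aestronglyMeasurable
  · exact fun y => .of_forall fun v => hM _
  · exact .of_forall fun v => hf.comp (by fun_prop : Continuous fun y => Φ y + s • v)

lemma abs_stepOp_le (Φ : E → E) (s : ℝ) (ν : Measure E) [IsProbabilityMeasure ν] {f : E → ℝ}
    {M : ℝ} (hM : ∀ x, |f x| ≤ M) (y : E) : |stepOp Φ s ν f y| ≤ M := by
  have := norm_integral_le_of_norm_le_const (μ := ν) (f := fun v => f (Φ y + s • v)) (C := M)
    (.of_forall fun v => hM _)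
  simpa [stepOp] using this

lemma integrable_of_continuous_of_abs_le {f : E → ℝ} (hf : Continuous f) {M : ℝ}
    (hM : ∀ x, |f x| ≤ M) (m : Measure E) [IsProbabilityMeasure m] : Integrable f m :=
  .of_bound hf.aestronglyMeasurable M (.of_forall hM)

lemma integral_stepLaw {Φ : E → E} (hΦ : Continuous Φ) (s : ℝ) (ν m : Measure E)
    [IsProbabilityMeasure ν] [IsProbabilityMeasure m] {f : E → ℝ} (hf : Continuous f) {M : ℝ}
    (hM : ∀ x, |f x| ≤ M) : ∫ x, f x ∂(stepLaw Φ s ν m) = ∫ y, stepOp Φ s ν f y ∂m := by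
  rw [stepLaw, integral_map (measurable_step hΦ s).aemeasurable hf.aestronglyMeasurable,
    integral_prod]
  · rfl
  · exact .of_bound (hf.measurable.comp (measurable_step hΦ s)).aestronglyMeasurable M
      (.of_forall fun _ => hM _)

lemma continuous_iterate_stepOp {Φ : E → E} (hΦ : Continuous Φ) (s : ℝ) (ν : Measure E)
    [IsProbabilityMeasure ν] {f : E → ℝ} (hf : Continuous f) {M : ℝ} (hM : ∀ x, |f x| ≤ M)
    (k : ℕ) : Continuous ((stepOp Φ s ν)^[k] f) ∧ ∀ x, |(stepOp Φ s ν)^[k] f x| ≤ M := by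
  induction k with
  | zero => exact ⟨hf, hM⟩
  | succ k ih =>
    rw [Function.iterate_succ_apply']
    exact ⟨continuous_stepOp hΦ s ν ih.1 ih.2, abs_stepOp_le Φ s ν ih.2⟩

lemma integral_iterate_stepLaw {Φ : E → E} (hΦ : Continuous Φ) (s : ℝ) (ν m : Measure E)
    [IsProbabilityMeasure ν] [IsProbabilityMeasure m] {f : E → ℝ} (hf : Continuous f) {M : ℝ}
    (hM : ∀ x, |f x| ≤ M) (k : ℕ) :
    ∫ x, f x ∂((stepLaw Φ s ν)^[k] m) = ∫ y, (stepOp Φ s ν)^[k] f y ∂m := by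
  induction k generalizing f with
  | zero => rfl
  | succ k ih =>
    have := isProbabilityMeasure_iterate_stepLaw hΦ s ν m k
    rw [Function.iterate_succ_apply', integral_stepLaw hΦ s ν _ hf hM,
      ih (continuous_stepOp hΦ s ν hf hM) (abs_stepOp_le Φ s ν hM), Function.iterate_succ_apply]

lemma continuous_of_abs_sub_le {D : E ≃L[ℝ] E} {f : E → ℝ} {L : ℝ}
    (hL : ∀ x y, |f x - f y| ≤ L * ‖D (x - y)‖) : Continuous f := by
  refine continuous_iff_continuousAt.2 fun x => ?_
  rw [ContinuousAt, tendsto_iff_dist_tendsto_zero]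
  refine squeeze_zero (fun _ => dist_nonneg) (fun y => hL y x) ?_
  have : Continuous fun y => L * ‖D (y - x)‖ := by fun_prop
  simpa using this.tendsto x

lemma continuous_of_norm_map_sub_le {D : E ≃L[ℝ] E} {Φ : E → E} {ρ : ℝ}
    (hΦ : ∀ x y, ‖D (Φ x - Φ y)‖ ≤ ρ * ‖D (x - y)‖) : Continuous Φ := by
  have h : Continuous fun x => D (Φ x) := by
    refine continuous_iff_continuousAt.2 fun x => ?_
    rw [ContinuousAt, tendsto_iff_norm_sub_tendsto_zero]
    have h0 : Continuous fun y => ρ * ‖D (y - x)‖ := by fun_prop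
    refine squeeze_zero (g := fun y => ρ * ‖D (y - x)‖) (fun _ => norm_nonneg _)
      (fun y => by rw [← map_sub]; exact hΦ y x) ?_
    simpa using h0.tendsto x
  simpa [Function.comp_def] using D.symm.continuous.comp h

variable {D : E ≃L[ℝ] E} {Φ : E → E} {ρ : ℝ}

/-- Synchronous coupling: with the same `v` on both sides the noise cancels in the difference, and
only the contraction `Φ` acts. -/
lemma abs_stepOp_sub_le (hΦ : ∀ x y, ‖D (Φ x - Φ y)‖ ≤ ρ * ‖D (x - y)‖) (s : ℝ) (ν : Measure E)
    [IsProbabilityMeasure ν] {f : E → ℝ} {M L : ℝ} (hM : ∀ x, |f x| ≤ M) (hL0 : 0 ≤ L)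
    (hL : ∀ x y, |f x - f y| ≤ L * ‖D (x - y)‖) (x y : E) :
    |stepOp Φ s ν f x - stepOp Φ s ν f y| ≤ ρ * L * ‖D (x - y)‖ := by
  have hf := continuous_of_abs_sub_le hL
  have hi : ∀ z, Integrable (fun v => f (Φ z + s • v)) ν := fun z =>
    integrable_of_continuous_of_abs_le (hf.comp (by fun_prop : Continuous fun v => Φ z + s • v))
      (fun v => hM _) ν
  rw [stepOp, stepOp, ← integral_sub (hi x) (hi y)]
  have := norm_integral_le_of_norm_le_const (μ := ν)
    (f := fun v => f (Φ x + s • v) - f (Φ y + s • v)) (C := ρ * L * ‖D (x - y)‖)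
    (.of_forall fun v => by
      refine (hL _ _).trans ?_
      rw [add_sub_add_right_eq_sub]
      nlinarith [hΦ x y])
  simpa using this

lemma abs_iterate_stepOp_sub_le (hΦ : ∀ x y, ‖D (Φ x - Φ y)‖ ≤ ρ * ‖D (x - y)‖) (hρ : 0 ≤ ρ)
    (s : ℝ) (ν : Measure E) [IsProbabilityMeasure ν] {f : E → ℝ} {M L : ℝ} (hM : ∀ x, |f x| ≤ M)
    (hL0 : 0 ≤ L) (hL : ∀ x y, |f x - f y| ≤ L * ‖D (x - y)‖) (k : ℕ) (x y : E) :
    |(stepOp Φ s ν)^[k] f x - (stepOp Φ s ν)^[k] f y| ≤ ρ ^ k * L * ‖D (x - y)‖ := by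
  induction k generalizing x y with
  | zero => simpa using hL x y
  | succ k ih =>
    rw [Function.iterate_succ_apply', pow_succ', mul_assoc ρ]
    exact abs_stepOp_sub_le hΦ s ν
      (continuous_iterate_stepOp (continuous_of_norm_map_sub_le hΦ) s ν
        (continuous_of_abs_sub_le hL) hM k).2 (by positivity) ih x y

/-- At the origin, successive iterates differ by the average of `P^k f (Φ 0 + s • v) - P^k f 0`,
where `P` is the Markov operator. This is at most `ρ ^ k` times a first moment, so the sequence is
Cauchy. Any other starting point shares the limit because `P^k f` has Lipschitz constant at most `ρ
^ k * L`. -/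
lemma exists_tendsto_iterate_stepOp (hΦ : ∀ x y, ‖D (Φ x - Φ y)‖ ≤ ρ * ‖D (x - y)‖) (hρ : 0 ≤ ρ)
    (hρ1 : ρ < 1) (s : ℝ) (ν : Measure E) [IsProbabilityMeasure ν]
    (hν : Integrable (fun v => v) ν) {f : E → ℝ} {M L : ℝ} (hM : ∀ x, |f x| ≤ M) (hL0 : 0 ≤ L)
    (hL : ∀ x y, |f x - f y| ≤ L * ‖D (x - y)‖) :
    ∃ l, ∀ x, Tendsto (fun k => (stepOp Φ s ν)^[k] f x) atTop (𝓝 l) := by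
  have hΦc := continuous_of_norm_map_sub_le hΦ
  have hfc := continuous_of_abs_sub_le hL
  have hcauchy : CauchySeq fun k => (stepOp Φ s ν)^[k] f 0 := by
    refine cauchySeq_of_le_geometric ρ (L * ∫ v, ‖D (Φ 0 + s • v)‖ ∂ν) hρ1 fun k => ?_
    obtain ⟨hc, hb⟩ := continuous_iterate_stepOp hΦc s ν hfc hM k
    have hi : Integrable (fun v => (stepOp Φ s ν)^[k] f (Φ 0 + s • v)) ν :=
      integrable_of_continuous_of_abs_le
        (hc.comp (by fun_prop : Continuous fun v => Φ 0 + s • v)) (fun v => hb _) ν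
    have hD : Integrable (fun v => ‖D (Φ 0 + s • v)‖) ν := by
      have h : Integrable (fun v => Φ 0 + s • v) ν := (integrable_const (Φ 0)).add (hν.smul s)
      exact (ContinuousLinearMap.integrable_comp (D : E →L[ℝ] E) h).norm
    rw [dist_comm, Real.dist_eq, Function.iterate_succ_apply']
    have h1 : stepOp Φ s ν ((stepOp Φ s ν)^[k] f) 0 - (stepOp Φ s ν)^[k] f 0 =
        ∫ v, ((stepOp Φ s ν)^[k] f (Φ 0 + s • v) - (stepOp Φ s ν)^[k] f 0) ∂ν := by
      rw [integral_sub hi (integrable_const _)]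
      simp [stepOp]
    rw [h1, mul_right_comm, ← integral_const_mul]
    refine abs_integral_le_integral_abs.trans (integral_mono ?_ ?_ fun v => ?_)
    · exact (hi.sub (integrable_const _)).abs
    · exact hD.const_mul _
    · have := abs_iterate_stepOp_sub_le hΦ hρ s ν hM hL0 hL k (Φ 0 + s • v) 0
      rw [sub_zero] at this
      simpa [mul_comm L] using this
  obtain ⟨l, hl⟩ := cauchySeq_tendsto_of_complete hcauchy
  refine ⟨l, fun x => ?_⟩
  have hdiff : Tendsto (fun k => (stepOp Φ s ν)^[k] f x - (stepOp Φ s ν)^[k] f 0) atTop (𝓝 0) := by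
    refine squeeze_zero_norm (abs_iterate_stepOp_sub_le hΦ hρ s ν hM hL0 hL · x 0) ?_
    simpa using ((tendsto_pow_atTop_nhds_zero_of_lt_one hρ hρ1).mul_const L).mul_const ‖D (x - 0)‖
  simpa using hdiff.add hl

lemma integrable_norm_map_sq (A : E →L[ℝ] E) {m : Measure E}
    (hm : MemLp (fun v => v) 2 m) : Integrable (fun v => ‖A v‖ ^ 2) m :=
  (A.comp_memLp' hm).integrable_norm_pow (by norm_num)

lemma integral_norm_map_add_smul_sq (A : E →L[ℝ] E) (a : E) (s : ℝ) (ν : Measure E)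
    [IsProbabilityMeasure ν] (hν : MemLp (fun v => v) 2 ν) (hν0 : ∫ v, v ∂ν = 0) :
    Integrable (fun v => ‖A (a + s • v)‖ ^ 2) ν ∧
    ∫ v, ‖A (a + s • v)‖ ^ 2 ∂ν = ‖A a‖ ^ 2 + s ^ 2 * ∫ v, ‖A v‖ ^ 2 ∂ν := by
  have h1 : Integrable (fun v => v) ν := hν.integrable (by norm_num)
  have h2 := integrable_norm_map_sq A hν
  have h3 : Integrable (fun v => inner ℝ (A a) (A v)) ν :=
    ((innerSL ℝ (A a)).comp A).integrable_comp h1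
  have h4 : ∫ v, inner ℝ (A a) (A v) ∂ν = 0 := by
    have := ((innerSL ℝ (A a)).comp A).integral_comp_comm h1
    simpa [hν0] using this
  have h5 : ∀ v, ‖A (a + s • v)‖ ^ 2 =
      (‖A a‖ ^ 2 + 2 * s * inner ℝ (A a) (A v)) + s ^ 2 * ‖A v‖ ^ 2 := by
    intro v
    rw [map_add, map_smul, norm_add_sq_real, real_inner_smul_right, norm_smul, mul_pow,
      Real.norm_eq_abs, sq_abs]
    ring
  simp_rw [h5]
  have h6 : Integrable (fun v => ‖A a‖ ^ 2 + 2 * s * inner ℝ (A a) (A v)) ν :=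
    (integrable_const (μ := ν) (‖A a‖ ^ 2)).add (h3.const_mul (2 * s))
  refine ⟨h6.add (h2.const_mul _), ?_⟩
  rw [integral_add h6 (h2.const_mul _), integral_add (integrable_const _) (h3.const_mul _),
    integral_const_mul, integral_const_mul, h4]
  simp

/-- The noise is centered, so the cross term vanishes and a step turns a second moment `M` into at
most `ρ ^ 2 * M + s ^ 2 * ∫ ‖D v‖ ^ 2`. Hence `hK` makes the bound `K` invariant. The Lebesgue
integral in `ENNReal` avoids presupposing integrability under `m`. -/
lemma lintegral_stepLaw_le (hΦ : ∀ x y, ‖D (Φ x - Φ y)‖ ≤ ρ * ‖D (x - y)‖)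
    (hΦ0 : Φ 0 = 0) (s : ℝ) (ν m : Measure E) [IsProbabilityMeasure ν] [IsProbabilityMeasure m]
    (hν : MemLp (fun v => v) 2 ν) (hν0 : ∫ v, v ∂ν = 0) {K : ℝ} (hK0 : 0 ≤ K)
    (hK : ρ ^ 2 * K + s ^ 2 * ∫ v, ‖D v‖ ^ 2 ∂ν ≤ K)
    (hm : ∫⁻ y, ENNReal.ofReal (‖D y‖ ^ 2) ∂m ≤ ENNReal.ofReal K) :
    ∫⁻ y, ENNReal.ofReal (‖D y‖ ^ 2) ∂(stepLaw Φ s ν m) ≤ ENNReal.ofReal K := by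
  have hΦc := continuous_of_norm_map_sub_le hΦ
  have hDm : Measurable fun y => ENNReal.ofReal (‖D y‖ ^ 2) := by fun_prop
  have hV : 0 ≤ s ^ 2 * ∫ v, ‖D v‖ ^ 2 ∂ν := by positivity
  rw [stepLaw, lintegral_map hDm (measurable_step hΦc s),
    lintegral_prod (fun p : E × E => ENNReal.ofReal (‖D (Φ p.1 + s • p.2)‖ ^ 2))
      (hDm.comp (measurable_step hΦc s)).aemeasurable]
  calc ∫⁻ y, ∫⁻ v, ENNReal.ofReal (‖D (Φ y + s • v)‖ ^ 2) ∂ν ∂m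
      ≤ ∫⁻ y, (ENNReal.ofReal (ρ ^ 2) * ENNReal.ofReal (‖D y‖ ^ 2)
          + ENNReal.ofReal (s ^ 2 * ∫ v, ‖D v‖ ^ 2 ∂ν)) ∂m := by
        refine lintegral_mono fun y => ?_
        obtain ⟨hi, he⟩ := integral_norm_map_add_smul_sq D.toContinuousLinearMap (Φ y) s ν hν hν0
        simp only [ContinuousLinearEquiv.coe_coe] at hi he
        rw [← ofReal_integral_eq_lintegral_ofReal hi (.of_forall fun _ => by positivity), he,
          ← ENNReal.ofReal_mul (by positivity), ← ENNReal.ofReal_add (by positivity) hV]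
        refine ENNReal.ofReal_le_ofReal (add_le_add_left ?_ _)
        have := hΦ y 0
        rw [hΦ0, sub_zero, sub_zero] at this
        rw [← mul_pow]
        gcongr
    _ = ENNReal.ofReal (ρ ^ 2) * ∫⁻ y, ENNReal.ofReal (‖D y‖ ^ 2) ∂m
          + ENNReal.ofReal (s ^ 2 * ∫ v, ‖D v‖ ^ 2 ∂ν) := by
        rw [lintegral_add_right _ measurable_const, lintegral_const_mul _ hDm]
        simp
    _ ≤ ENNReal.ofReal (ρ ^ 2) * ENNReal.ofReal K
          + ENNReal.ofReal (s ^ 2 * ∫ v, ‖D v‖ ^ 2 ∂ν) := by gcongr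
    _ ≤ ENNReal.ofReal K := by
        rw [← ENNReal.ofReal_mul (by positivity), ← ENNReal.ofReal_add (by positivity) hV]
        exact ENNReal.ofReal_le_ofReal hK

/-- Markov's inequality, on the compact ellipsoids `‖D y‖ ≤ n`. -/
lemma isTightMeasureSet_of_lintegral_sq_le (D : E ≃L[ℝ] E) {S : Set (Measure E)} {K : ℝ}
    (hS : ∀ m ∈ S, ∫⁻ y, ENNReal.ofReal (‖D y‖ ^ 2) ∂m ≤ ENNReal.ofReal K) :
    IsTightMeasureSet S := by
  refine isTightMeasureSet_iff_exists_isCompact_measure_compl_le.2 fun ε hε => ?_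
  have hlim : Tendsto (fun n : ℕ => ENNReal.ofReal K / ENNReal.ofReal ((n : ℝ) ^ 2)) atTop (𝓝 0) := by
    rw [← ENNReal.div_top (a := ENNReal.ofReal K)]
    refine ENNReal.Tendsto.const_div ?_ (.inr ENNReal.ofReal_ne_top)
    exact ENNReal.tendsto_ofReal_atTop.comp
      ((tendsto_pow_atTop two_ne_zero).comp tendsto_natCast_atTop_atTop)
  obtain ⟨n, hn, hn0⟩ := ((hlim.eventually_lt_const hε).and (eventually_gt_atTop 0)).exists
  refine ⟨D ⁻¹' Metric.closedBall 0 n, D.toHomeomorph.isCompact_preimage.2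
    (isCompact_closedBall _ _), fun m hm => ?_⟩
  have hn' : (0 : ℝ) < n := by exact_mod_cast hn0
  refine le_trans ?_ hn.le
  refine le_trans ?_ (ENNReal.div_le_div_right (hS m hm) _)
  refine le_trans (measure_mono fun y hy => ?_) (meas_ge_le_lintegral_div (by fun_prop)
    (by simpa using hn'.ne') ENNReal.ofReal_ne_top)
  refine ENNReal.ofReal_le_ofReal ?_
  have : (n : ℝ) < ‖D y‖ := by simpa using hy
  gcongr

/-- A contractive Markov step has a square integrable stationary law, to which the laws of the
iterates from any point converge. -/
theorem exists_stationary_law (hΦ : ∀ x y, ‖D (Φ x - Φ y)‖ ≤ ρ * ‖D (x - y)‖) (hρ : 0 ≤ ρ)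
    (hρ1 : ρ < 1) (hΦ0 : Φ 0 = 0) (s : ℝ) (ν : Measure E) [IsProbabilityMeasure ν]
    (hν : MemLp (fun v => v) 2 ν) (hν0 : ∫ v, v ∂ν = 0) {K : ℝ} (hK0 : 0 ≤ K)
    (hK : ρ ^ 2 * K + s ^ 2 * ∫ v, ‖D v‖ ^ 2 ∂ν ≤ K) :
    ∃ π : ProbabilityMeasure E,
      (∀ (x : E) (m : ℕ → ProbabilityMeasure E),
        (∀ k, (m k : Measure E) = (stepLaw Φ s ν)^[k] (Measure.dirac x)) →
        Tendsto m atTop (𝓝 π)) ∧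
      stepLaw Φ s ν π = π ∧
      ∫⁻ y, ENNReal.ofReal (‖D y‖ ^ 2) ∂(π : Measure E) ≤ ENNReal.ofReal K := by
  have hΦc := continuous_of_norm_map_sub_le hΦ
  have hν1 : Integrable (fun v => v) ν := hν.integrable (by norm_num)
  let m₀ : ℕ → ProbabilityMeasure E := fun k => ⟨(stepLaw Φ s ν)^[k] (Measure.dirac 0),
    isProbabilityMeasure_iterate_stepLaw hΦc s ν _ k⟩
  have hm₀K : ∀ k, ∫⁻ y, ENNReal.ofReal (‖D y‖ ^ 2) ∂(m₀ k : Measure E) ≤ ENNReal.ofReal K := by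
    intro k
    induction k with
    | zero =>
      change ∫⁻ y, ENNReal.ofReal (‖D y‖ ^ 2) ∂(Measure.dirac 0) ≤ _
      simp [lintegral_dirac]
    | succ k ih =>
      change ∫⁻ y, ENNReal.ofReal (‖D y‖ ^ 2) ∂((stepLaw Φ s ν)^[k + 1] (Measure.dirac 0)) ≤ _
      rw [Function.iterate_succ_apply']
      have := isProbabilityMeasure_iterate_stepLaw hΦc s ν (Measure.dirac 0) k
      exact lintegral_stepLaw_le hΦ hΦ0 s ν _ hν hν0 hK0 hK ih
  have htight : IsTightMeasureSet {((m : ProbabilityMeasure E) : Measure E) | m ∈ Set.range m₀} := by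
    refine isTightMeasureSet_of_lintegral_sq_le D (K := K) ?_
    rintro _ ⟨_, ⟨k, rfl⟩, rfl⟩
    exact hm₀K k
  have hcompact := isCompact_closure_of_isTightMeasureSet htight
  -- A limit along an ultrafilter suffices: on bounded Lipschitz functions the integrals already
  -- converge along `atTop`, so they have the same limit along `hyperfilter ℕ`.
  obtain ⟨π, -, hπ⟩ := hcompact.ultrafilter_le_nhds ((hyperfilter ℕ).map m₀)
    (.trans (by simp) (Filter.monotone_principal subset_closure))
  have hU : Tendsto m₀ (hyperfilter ℕ) (𝓝 π) := hπ
  -- the limits of the Markov iterates are the integrals against `π`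
  have key : ∀ {f : E → ℝ} {M L : ℝ}, (∀ x, |f x| ≤ M) → 0 ≤ L →
      (∀ x y, |f x - f y| ≤ L * ‖D (x - y)‖) → ∀ x, Tendsto (fun k => (stepOp Φ s ν)^[k] f x) atTop
        (𝓝 (∫ y, f y ∂(π : Measure E))) := by
    intro f M L hM hL0 hL x
    have hfc := continuous_of_abs_sub_le hL
    obtain ⟨l, hl⟩ := exists_tendsto_iterate_stepOp hΦ hρ hρ1 s ν hν1 hM hL0 hL
    have h1 : Tendsto (fun k => ∫ y, f y ∂(m₀ k : Measure E)) (hyperfilter ℕ) (𝓝 l) := by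
      have h0 : ∀ k, ∫ y, f y ∂(m₀ k : Measure E) = (stepOp Φ s ν)^[k] f 0 := fun k => by
        change ∫ y, f y ∂((stepLaw Φ s ν)^[k] (Measure.dirac 0)) = _
        rw [integral_iterate_stepLaw hΦc s ν _ hfc hM, integral_dirac]
      simp_rw [h0]
      exact (hl 0).mono_left Nat.hyperfilter_le_atTop
    have h2 := ProbabilityMeasure.tendsto_iff_forall_integral_tendsto.1 hU
      (BoundedContinuousFunction.ofNormedAddCommGroup f hfc M hM)
    have : l = ∫ y, f y ∂(π : Measure E) := tendsto_nhds_unique h1 (by simpa using h2)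
    exact this ▸ hl x
  have hlip : ∀ {f : E → ℝ}, (∃ C : ℝ, ∀ x y, dist (f x) (f y) ≤ C) → (∃ L, LipschitzWith L f) →
      ∃ M L : ℝ, (∀ x, |f x| ≤ M) ∧ 0 ≤ L ∧ ∀ x y, |f x - f y| ≤ L * ‖D (x - y)‖ := by
    rintro f ⟨C, hC⟩ ⟨L, hL⟩
    refine ⟨|f 0| + C, L * ‖D.symm.toContinuousLinearMap‖, fun x => ?_, by positivity,
      fun x y => ?_⟩
    · have := hC x 0
      rw [Real.dist_eq] at this
      have h3 := abs_sub_abs_le_abs_sub (f x) (f 0)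
      linarith
    · refine (hL.dist_le_mul x y).trans ?_
      rw [mul_assoc]
      gcongr
      rw [dist_eq_norm]
      simpa using D.symm.toContinuousLinearMap.le_opNorm (D (x - y))
  have hconv : ∀ (x : E) (m : ℕ → ProbabilityMeasure E),
      (∀ k, (m k : Measure E) = (stepLaw Φ s ν)^[k] (Measure.dirac x)) →
      Tendsto m atTop (𝓝 π) := by
    intro x m hm
    refine tendsto_iff_forall_lipschitz_integral_tendsto.2 fun f hf hfL => ?_
    obtain ⟨M, L, hM, hL0, hL⟩ := hlip hf hfL
    have hfc := continuous_of_abs_sub_le hL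
    simp_rw [hm, integral_iterate_stepLaw hΦc s ν _ hfc hM, integral_dirac]
    exact key hM hL0 hL x
  refine ⟨π, hconv, ?_, ?_⟩
  -- Stationarity: for bounded Lipschitz `f`, `key` applied to `stepOp f` and to `f` evaluates the
  -- limit of the same sequence, shifted by one, as `∫ stepOp f ∂π` and as `∫ f ∂π`.
  · have hp := isProbabilityMeasure_stepLaw hΦc s ν (π : Measure E)
    let π' : ProbabilityMeasure E := ⟨stepLaw Φ s ν π, hp⟩
    suffices h : Tendsto (fun _ : ℕ => π) atTop (𝓝 π') by
      have := tendsto_nhds_unique h tendsto_const_nhds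
      exact congrArg ProbabilityMeasure.toMeasure this
    refine tendsto_iff_forall_lipschitz_integral_tendsto.2 fun f hf hfL => ?_
    obtain ⟨M, L, hM, hL0, hL⟩ := hlip hf hfL
    have hfc := continuous_of_abs_sub_le hL
    have h1 : ∫ y, f y ∂(π' : Measure E) = ∫ y, stepOp Φ s ν f y ∂(π : Measure E) :=
      integral_stepLaw hΦc s ν _ hfc hM
    have h2 := key (abs_stepOp_le Φ s ν hM) (by positivity) (abs_stepOp_sub_le hΦ s ν hM hL0 hL) 0
    have h3 := (tendsto_add_atTop_iff_nat 1).2 (key hM hL0 hL 0)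
    simp_rw [Function.iterate_succ_apply] at h3
    rw [h1, tendsto_nhds_unique h2 h3]
    exact tendsto_const_nhds
  -- The moment bound passes to the weak limit by lower semicontinuity, from the portmanteau
  -- inequality on open sets.
  · have hm₀ := hconv 0 m₀ fun k => rfl
    have := lintegral_le_liminf_lintegral_of_forall_isOpen_measure_le_liminf_measure
      (μ := (π : Measure E)) (μs := fun k => (m₀ k : Measure E)) (f := fun y => ‖D y‖ ^ 2)
      (by fun_prop) (fun _ => by positivity)
      (fun G hG => ProbabilityMeasure.le_liminf_measure_open_of_tendsto hm₀ hG)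
    refine this.trans ?_
    exact liminf_le_of_le (by isBoundedDefault) fun b hb => by
      obtain ⟨k, hk⟩ := hb.exists
      exact hk.trans (hm₀K k)

end MarkovStep

/-! ### Second-order expansions and the telescoping estimate -/

section CharFunLimit

variable {E : Type*} [NormedAddCommGroup E] [InnerProductSpace ℝ E] [FiniteDimensional ℝ E]
  [MeasurableSpace E] [BorelSpace E]

lemma norm_cexp_mul_I_sub_le (a b : ℝ) :
    ‖Complex.exp (a * Complex.I) - Complex.exp (b * Complex.I)‖ ≤ |a - b| := by
  have h : Complex.exp (a * Complex.I) - Complex.exp (b * Complex.I) =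
      Complex.exp (b * Complex.I) * (Complex.exp (Complex.I * ((a - b : ℝ) : ℂ)) - 1) := by
    rw [mul_sub, ← Complex.exp_add, mul_one]
    push_cast
    ring_nf
  rw [h, norm_mul, Complex.norm_exp_ofReal_mul_I, one_mul]
  exact Real.norm_exp_I_mul_ofReal_sub_one_le

/-- The remainder of the second order expansion of `u ↦ exp (i u)` at `0`. -/
noncomputable def cexpRemainder (u : ℝ) : ℂ :=
  Complex.exp (u * Complex.I) - 1 - u * Complex.I + ((u ^ 2 / 2 : ℝ) : ℂ)

lemma norm_cexpRemainder_le_cube {u : ℝ} (hu : |u| ≤ 1) : ‖cexpRemainder u‖ ≤ |u| ^ 3 := by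
  have hn : ‖(u : ℂ) * Complex.I‖ = |u| := by simp
  have h := Complex.exp_bound (x := u * Complex.I) (by rwa [hn]) (n := 3) (by norm_num)
  have he : Complex.exp (u * Complex.I) -
      ∑ m ∈ Finset.range 3, ((u : ℂ) * Complex.I) ^ m / (m.factorial : ℂ) = cexpRemainder u := by
    simp only [Finset.sum_range_succ, Finset.sum_range_zero, cexpRemainder]
    push_cast [Nat.factorial]
    ring_nf
    simp only [Complex.I_sq]
    ring
  rw [he, hn] at h
  refine h.trans ?_
  norm_num [Nat.factorial]
  nlinarith [pow_nonneg (abs_nonneg u) 3]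

/-- The quadratic bound holds for all `u` and serves as the dominating function; the cubic bound
near `0` supplies pointwise decay. Together they require only a second moment of the noise. -/
lemma norm_cexpRemainder_le_sq (u : ℝ) : ‖cexpRemainder u‖ ≤ 4 * u ^ 2 := by
  rcases le_total |u| 1 with hu | hu
  · refine (norm_cexpRemainder_le_cube hu).trans ?_
    rw [← sq_abs u]
    nlinarith [abs_nonneg u, sq_nonneg |u|]
  · have h1 : ‖cexpRemainder u‖ ≤ 1 + 1 + |u| + u ^ 2 / 2 := by
      refine (norm_add_le _ _).trans (add_le_add ((norm_sub_le _ _).trans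
        (add_le_add ((norm_sub_le _ _).trans ?_) ?_)) ?_)
      · rw [Complex.norm_exp_ofReal_mul_I]; simp
      · simp
      · rw [Complex.norm_real, Real.norm_eq_abs, abs_of_nonneg (by positivity)]
    nlinarith [sq_abs u]

lemma continuous_cexpRemainder : Continuous cexpRemainder := by
  unfold cexpRemainder
  fun_prop

lemma charFun_sub_one_add_eq (ν : Measure E) [IsProbabilityMeasure ν]
    (hν : MemLp (fun v => v) 2 ν) (hν0 : ∫ v, v ∂ν = 0) (t : E) :
    charFun ν t - 1 + (((∫ v, inner ℝ v t ^ 2 ∂ν) / 2 : ℝ) : ℂ) =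
      ∫ v, cexpRemainder (inner ℝ v t) ∂ν := by
  have h1 : Integrable (fun v => v) ν := hν.integrable (by norm_num)
  have hin : Integrable (fun v => inner ℝ v t) ν := h1.inner_const t
  have hin0 : ∫ v, inner ℝ v t ∂ν = 0 := by
    simp_rw [real_inner_comm t]
    rw [integral_inner h1, hν0, inner_zero_right]
  have hsq : Integrable (fun v => inner ℝ v t ^ 2) ν := by
    have : Integrable (fun v => ‖v‖ ^ 2) ν := hν.integrable_norm_pow (by norm_num)
    refine (this.mul_const (‖t‖ ^ 2)).mono' (by fun_prop) (.of_forall fun v => ?_)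
    rw [Real.norm_eq_abs, abs_of_nonneg (by positivity), ← mul_pow, ← sq_abs]
    gcongr
    exact abs_real_inner_le_norm v t
  have hexp : Integrable (fun v => Complex.exp ((inner ℝ v t : ℝ) * Complex.I)) ν :=
    .of_bound (by fun_prop) 1 (.of_forall fun v => by rw [Complex.norm_exp_ofReal_mul_I])
  have hlin : Integrable (fun v => ((inner ℝ v t : ℝ) : ℂ) * Complex.I) ν :=
    hin.ofReal.mul_const _
  have hq : Integrable (fun v => ((inner ℝ v t ^ 2 / 2 : ℝ) : ℂ)) ν := (hsq.div_const 2).ofReal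
  have hexp1 : Integrable (fun v => Complex.exp ((inner ℝ v t : ℝ) * Complex.I) - 1) ν :=
    hexp.sub (integrable_const _)
  have hexp2 : Integrable (fun v => Complex.exp ((inner ℝ v t : ℝ) * Complex.I) - 1 -
    ((inner ℝ v t : ℝ) : ℂ) * Complex.I) ν := hexp1.sub hlin
  unfold cexpRemainder
  rw [integral_add hexp2 hq, integral_sub hexp1 hlin, integral_sub hexp (integrable_const _),
    integral_mul_const, integral_complex_ofReal, integral_complex_ofReal, hin0, integral_div,
    charFun_apply]
  simp

/-- The second order expansion of the characteristic function of a centered law at `0`. -/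
lemma exists_norm_charFun_sub_le (ν : Measure E) [IsProbabilityMeasure ν]
    (hν : MemLp (fun v => v) 2 ν) (hν0 : ∫ v, v ∂ν = 0) {ε : ℝ} (hε : 0 < ε) :
    ∃ r > 0, ∀ t : E, ‖t‖ < r →
      ‖charFun ν t - 1 + (((∫ v, inner ℝ v t ^ 2 ∂ν) / 2 : ℝ) : ℂ)‖ ≤ ε * ‖t‖ ^ 2 := by
  -- Dominated convergence for the remainder divided by `‖t‖ ^ 2`: the bound is `4 * ‖v‖ ^ 2`, and
  -- for fixed `v` the quotient is `O(‖t‖)`. At `t = 0` the inverse is `0`, which is harmless.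
  have hlim : Tendsto (fun t : E => ∫ v, ((‖t‖ ^ 2)⁻¹ : ℝ) • cexpRemainder (inner ℝ v t) ∂ν)
      (𝓝 0) (𝓝 (∫ _, 0 ∂ν)) := by
    refine tendsto_integral_filter_of_dominated_convergence (fun v => 4 * ‖v‖ ^ 2) ?_ ?_ ?_ ?_
    · refine .of_forall fun t => (Continuous.aestronglyMeasurable ?_)
      have := continuous_cexpRemainder
      fun_prop
    · refine .of_forall fun t => .of_forall fun v => ?_
      rw [norm_smul, norm_inv, norm_pow, norm_norm]
      rcases eq_or_ne t 0 with rfl | ht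
      · simp
      rw [inv_mul_le_iff₀ (by positivity)]
      refine (norm_cexpRemainder_le_sq _).trans ?_
      have := abs_real_inner_le_norm v t
      rw [← sq_abs]
      calc 4 * |inner ℝ v t| ^ 2 ≤ 4 * (‖v‖ * ‖t‖) ^ 2 := by gcongr
        _ = _ := by ring
    · exact (hν.integrable_norm_pow (by norm_num)).const_mul 4
    · refine .of_forall fun v => ?_
      have h0 : Continuous fun t : E => ‖v‖ * ‖t‖ := by fun_prop
      have hev : ∀ᶠ t : E in 𝓝 0, ‖v‖ * ‖t‖ < 1 :=
        (h0.tendsto 0).eventually_lt_const (by simp)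
      have h1 : Tendsto (fun t : E => ‖v‖ ^ 3 * ‖t‖) (𝓝 0) (𝓝 0) := by
        have : Continuous fun t : E => ‖v‖ ^ 3 * ‖t‖ := by fun_prop
        simpa using this.tendsto 0
      refine squeeze_zero_norm' ?_ h1
      filter_upwards [hev] with t ht
      have hi := abs_real_inner_le_norm v t
      rw [norm_smul, norm_inv, norm_pow, norm_norm]
      rcases eq_or_ne t 0 with rfl | ht0
      · simp
      rw [inv_mul_le_iff₀ (by positivity)]
      refine (norm_cexpRemainder_le_cube (hi.trans ht.le)).trans ?_
      calc |inner ℝ v t| ^ 3 ≤ (‖v‖ * ‖t‖) ^ 3 := by gcongr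
        _ = _ := by ring
  rw [integral_zero] at hlim
  obtain ⟨r, hr, h⟩ := Metric.eventually_nhds_iff.1
    (hlim.norm.eventually_lt_const (by simpa using hε))
  refine ⟨r, hr, fun t ht => ?_⟩
  rcases eq_or_ne t 0 with rfl | ht0
  · simp
  have h2 := h (y := t) (by simpa using ht)
  rw [integral_smul, norm_smul, norm_inv, norm_pow, norm_norm,
    inv_mul_lt_iff₀ (by positivity)] at h2
  rw [charFun_sub_one_add_eq ν hν hν0, mul_comm]
  exact h2.le

/-- Differentiability gives the `ε`-term when `‖h‖ < r`. For `‖h‖ ≥ r` the remainder grows at most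
linearly, and `‖h‖ ≤ ‖h‖ ^ 2 / r` absorbs it in the quadratic term. The bound is thus global and can
be integrated using second moments alone. -/
lemma exists_norm_sub_fderiv_le {T : E → E} {L : E →L[ℝ] E} {x : E} (hT : HasFDerivAt T L x)
    {c : ℝ} (hc : ∀ y, ‖T y - T x‖ ≤ c * ‖y - x‖) {ε : ℝ} (hε : 0 < ε) :
    ∃ c' ≥ 0, ∀ h, ‖T (h + x) - T x - L h‖ ≤ ε * ‖h‖ + c' * ‖h‖ ^ 2 := by
  obtain ⟨r, hr, hrT⟩ := Metric.eventually_nhds_iff.1 (hT.isLittleO.def hε)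
  refine ⟨(|c| + ‖L‖) / r, by positivity, fun h => ?_⟩
  by_cases hh : ‖h‖ < r
  · have := hrT (y := h + x) (by simpa using hh)
    rw [add_sub_cancel_right] at this
    exact this.trans (le_add_of_nonneg_right (by positivity))
  · have h1 := hc (h + x)
    rw [add_sub_cancel_right] at h1
    have h2 : ‖T (h + x) - T x - L h‖ ≤ (|c| + ‖L‖) * ‖h‖ := by
      refine (norm_sub_le _ _).trans ?_
      have h3 := L.le_opNorm h
      have h4 : c * ‖h‖ ≤ |c| * ‖h‖ := by gcongr; exact le_abs_self c
      linarith
    have h5 : (|c| + ‖L‖) * ‖h‖ ≤ (|c| + ‖L‖) / r * ‖h‖ ^ 2 := by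
      rw [div_mul_eq_mul_div, le_div_iff₀ hr, mul_assoc]
      have : ‖h‖ * r ≤ ‖h‖ ^ 2 := by nlinarith [norm_nonneg h, not_lt.1 hh]
      gcongr
    have : 0 ≤ ε * ‖h‖ := by positivity
    linarith

/-- Since `n (B t) ≤ ρ * n t`, the error `κ * (1 - ρ) * n t` is at most `κ * (n t - n (B t))`, which
telescopes along the orbit of `t`. The orbit tends to `0`, where `h` vanishes in the limit. -/
lemma le_mul_of_le_comp_add {h n : E → ℝ} {B : E → E} {R ρ c : ℝ} (hn0 : ∀ t, 0 ≤ n t)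
    (hn : ∀ t, ‖t‖ ≤ c * n t) (hρ0 : 0 ≤ ρ) (hρ1 : ρ < 1) (hB : ∀ t, n (B t) ≤ ρ * n t)
    (hh : Tendsto h (𝓝 0) (𝓝 0)) {κ : ℝ} (hκ : 0 ≤ κ)
    (hstep : ∀ t, n t ≤ R → h t ≤ h (B t) + κ * (1 - ρ) * n t) {t : E} (ht : n t ≤ R) :
    h t ≤ κ * n t := by
  have hpow : ∀ k, n (B^[k] t) ≤ ρ ^ k * n t := fun k => by
    induction k with
    | zero => simp
    | succ k ih =>
      rw [Function.iterate_succ_apply', pow_succ', mul_assoc]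
      exact (hB _).trans (by gcongr)
  have hle : ∀ k, n (B^[k] t) ≤ R := fun k =>
    ((hpow k).trans (mul_le_of_le_one_left (hn0 t) (pow_le_one₀ hρ0 hρ1.le))).trans ht
  have htel : ∀ k, h t ≤ h (B^[k] t) + κ * (n t - n (B^[k] t)) := fun k => by
    induction k with
    | zero => simp
    | succ k ih =>
      have h1 := hstep _ (hle k)
      rw [Function.iterate_succ_apply']
      nlinarith [mul_le_mul_of_nonneg_left (hB (B^[k] t)) hκ]
  have hzero : Tendsto (fun k => B^[k] t) atTop (𝓝 0) := by
    have hb : Tendsto (fun k => |c| * (ρ ^ k * n t)) atTop (𝓝 0) := by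
      simpa using ((tendsto_pow_atTop_nhds_zero_of_lt_one hρ0 hρ1).mul_const (n t)).const_mul |c|
    refine squeeze_zero_norm (fun k => (hn _).trans ?_) hb
    exact mul_le_mul (le_abs_self c) (hpow k) (hn0 _) (abs_nonneg c)
  have hlim : Tendsto (fun k => h (B^[k] t) + κ * n t) atTop (𝓝 (0 + κ * n t)) :=
    (hh.comp hzero).add_const _
  rw [zero_add] at hlim
  refine ge_of_tendsto' hlim fun k => (htel k).trans ?_
  nlinarith [mul_nonneg hκ (hn0 (B^[k] t))]

/-- The upper bound comes from `1 - a ≤ exp (-a)`, the lower one from `exp (a - b) ≥ 1 + a - b`. -/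
lemma abs_exp_sub_mul_one_sub_sub_one_le {a b : ℝ} (ha0 : 0 ≤ a) (ha1 : a ≤ 1) (hb : 0 ≤ b) :
    |Real.exp (a - b) * (1 - a) - 1| ≤ a ^ 2 + b := by
  have h1 : Real.exp (a - b) * (1 - a) ≤ 1 := by
    have h2 : 1 - a ≤ Real.exp (-a) := by linarith [Real.add_one_le_exp (-a)]
    calc Real.exp (a - b) * (1 - a) ≤ Real.exp a * Real.exp (-a) := by
          gcongr
          linarith
      _ = 1 := by rw [← Real.exp_add]; simp
  have h3 := mul_le_mul_of_nonneg_right (Real.add_one_le_exp (a - b)) (sub_nonneg.2 ha1)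
  rw [abs_le]
  constructor <;> nlinarith [mul_nonneg ha0 hb]

lemma charFun_stepLaw {Φ : E → E} (hΦ : Continuous Φ) (s : ℝ) (ν m : Measure E)
    [IsProbabilityMeasure ν] [IsProbabilityMeasure m] (t : E) :
    charFun (stepLaw Φ s ν m) t =
      (∫ y, Complex.exp ((inner ℝ (Φ y) t : ℝ) * Complex.I) ∂m) * charFun ν (s • t) := by
  rw [charFun_apply, stepLaw, integral_map (measurable_step hΦ s).aemeasurable (by fun_prop),
    charFun_apply, ← integral_prod_mul]
  refine integral_congr_ae (.of_forall fun p => ?_)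
  simp only
  rw [← Complex.exp_add, inner_add_left, real_inner_smul_left, real_inner_smul_right]
  push_cast
  ring_nf

end CharFunLimit

/-! ### Convergence of the stationary characteristic functions -/

section StationaryCharFun

variable {E : Type*} [NormedAddCommGroup E] [InnerProductSpace ℝ E] [FiniteDimensional ℝ E]
  [MeasurableSpace E] [BorelSpace E]

/-- The deterministic part of one step of the centered scaled iterates. -/
noncomputable def driftStep (T : E → E) (xs : E) (α : ℝ) (y : E) : E :=
  y + √α • (T (√α • y + xs) - (√α • y + xs))

/-- The adjoint of the linearized step `y ↦ y + α (L y - y)`. -/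
noncomputable def adjointStep (L : E →L[ℝ] E) (α : ℝ) (t : E) : E :=
  t + α • (ContinuousLinearMap.adjoint L t - t)

/-- The adjoint moves the linearized drift onto the frequency `t`, leaving only the Taylor remainder
of `T`. -/
lemma inner_driftStep_sub {T : E → E} {xs : E} (hxs : T xs = xs) (L : E →L[ℝ] E) {α : ℝ}
    (hα : 0 ≤ α) (y t : E) :
    inner ℝ (driftStep T xs α y) t - inner ℝ y (adjointStep L α t) =
      √α * inner ℝ (T (√α • y + xs) - T xs - L (√α • y)) t := by
  have h : α = √α * √α := (Real.mul_self_sqrt hα).symm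
  simp only [driftStep, adjointStep, inner_add_left, inner_add_right, inner_sub_left,
    inner_sub_right, real_inner_smul_left, real_inner_smul_right, map_smul,
    ContinuousLinearMap.adjoint_inner_right, hxs]
  generalize √α = s at *
  subst h
  ring

lemma norm_integral_driftStep_sub_charFun_le {T : E → E} (hTc : Continuous T) {xs : E}
    (hxs : T xs = xs) {L : E →L[ℝ] E} {ε c' : ℝ} (hε : 0 ≤ ε)
    (hr : ∀ h, ‖T (h + xs) - T xs - L h‖ ≤ ε * ‖h‖ + c' * ‖h‖ ^ 2) {α : ℝ}
    (hα : 0 ≤ α) (m : Measure E) [IsProbabilityMeasure m] (hm : Integrable (fun y => ‖y‖ ^ 2) m)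
    (t : E) :
    ‖∫ y, Complex.exp ((inner ℝ (driftStep T xs α y) t : ℝ) * Complex.I) ∂m -
      charFun m (adjointStep L α t)‖ ≤
      α * ‖t‖ * (ε * (1 + ∫ y, ‖y‖ ^ 2 ∂m) + √α * c' * ∫ y, ‖y‖ ^ 2 ∂m) := by
  have hΦ : Continuous (driftStep T xs α) := by unfold driftStep; fun_prop
  have hi1 : Integrable (fun y => Complex.exp ((inner ℝ (driftStep T xs α y) t : ℝ) * Complex.I)) m :=
    .of_bound (by fun_prop) 1 (.of_forall fun v => by rw [Complex.norm_exp_ofReal_mul_I])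
  have hi2 : Integrable (fun y => Complex.exp ((inner ℝ y (adjointStep L α t) : ℝ) * Complex.I)) m :=
    .of_bound (by fun_prop) 1 (.of_forall fun v => by rw [Complex.norm_exp_ofReal_mul_I])
  have hb1 : Integrable (fun y => 1 + ‖y‖ ^ 2) m := (integrable_const 1).add hm
  have hb : Integrable (fun y => ε * (1 + ‖y‖ ^ 2) + √α * c' * ‖y‖ ^ 2) m :=
    (hb1.const_mul ε).add (hm.const_mul _)
  rw [charFun_apply, ← integral_sub hi1 hi2]
  calc _ ≤ ∫ y, α * ‖t‖ * (ε * (1 + ‖y‖ ^ 2) + √α * c' * ‖y‖ ^ 2) ∂m := by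
        refine norm_integral_le_of_norm_le (hb.const_mul _) (.of_forall fun y => ?_)
        refine (norm_cexp_mul_I_sub_le _ _).trans ?_
        rw [inner_driftStep_sub hxs L hα, abs_mul, abs_of_nonneg (Real.sqrt_nonneg α)]
        have h1 := (abs_real_inner_le_norm (T (√α • y + xs) - T xs - L (√α • y)) t)
        have h2 := hr (√α • y)
        rw [norm_smul, Real.norm_eq_abs, abs_of_nonneg (Real.sqrt_nonneg α), mul_pow] at h2
        have h3 : ‖y‖ ≤ 1 + ‖y‖ ^ 2 := by nlinarith [sq_nonneg (‖y‖ - 1)]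
        calc √α * |inner ℝ (T (√α • y + xs) - T xs - L (√α • y)) t|
            ≤ √α * ((ε * (√α * ‖y‖) + c' * (√α ^ 2 * ‖y‖ ^ 2)) * ‖t‖) := by
              gcongr
              exact h1.trans (by gcongr)
          _ = √α ^ 2 * ‖t‖ * (ε * ‖y‖ + √α * c' * ‖y‖ ^ 2) := by ring
          _ ≤ α * ‖t‖ * (ε * (1 + ‖y‖ ^ 2) + √α * c' * ‖y‖ ^ 2) := by
              rw [Real.sq_sqrt hα]
              gcongr
    _ = _ := by
        rw [integral_const_mul, integral_add (hb1.const_mul ε) (hm.const_mul _),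
          integral_const_mul, integral_const_mul, integral_add (integrable_const _) hm]
        simp

/-- The four terms separate the error sources: linearization of the drift, the error at the next
frequency, expansion of the noise, and the defect of the Gaussian in its own recursion. -/
lemma norm_mul_sub_le {z w x u p : ℂ} {a : ℝ} (hx : ‖x‖ ≤ 1) (hu : ‖u‖ ≤ 1) :
    ‖z * x - p‖ ≤ ‖z - w‖ + ‖w - u‖ + ‖x - 1 + (a : ℂ)‖ + ‖u * (1 - a) - p‖ := by
  have h : z * x - p = (z - w) * x + (w - u) * x + u * (x - 1 + a) + (u * (1 - a) - p) := by ring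
  rw [h]
  refine norm_add₄_le.trans ?_
  simp only [norm_mul]
  gcongr
  · exact mul_le_of_le_one_right (norm_nonneg _) hx
  · exact mul_le_of_le_one_right (norm_nonneg _) hx
  · exact mul_le_of_le_one_left (norm_nonneg _) hu

lemma integral_inner_sq_le (ν : Measure E) (hν : MemLp (fun v => v) 2 ν) (t : E) :
    ∫ v, inner ℝ v t ^ 2 ∂ν ≤ (∫ v, ‖v‖ ^ 2 ∂ν) * ‖t‖ ^ 2 := by
  have h : Integrable (fun v => ‖v‖ ^ 2) ν := hν.integrable_norm_pow (by norm_num)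
  rw [← integral_mul_const]
  refine integral_mono_of_nonneg (.of_forall fun v => by positivity) (h.mul_const _)
    (.of_forall fun v => ?_)
  simp only
  rw [← mul_pow, ← sq_abs]
  gcongr
  exact abs_real_inner_le_norm v t

/-- One step of the comparison of the characteristic function of a stationary law with
`t ↦ exp (- Q t / 2)`. -/
lemma norm_charFun_sub_exp_le_step {T : E → E} (hTc : Continuous T) {xs : E}
    (hxs : T xs = xs) {L : E →L[ℝ] E} {ε c' ε₂ K V C r : ℝ} (hε : 0 ≤ ε) (hc' : 0 ≤ c')
    (hr : ∀ h, ‖T (h + xs) - T xs - L h‖ ≤ ε * ‖h‖ + c' * ‖h‖ ^ 2) {α : ℝ}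
    (hα : 0 < α) (ν m : Measure E) [IsProbabilityMeasure ν] [IsProbabilityMeasure m]
    (hm : Integrable (fun y => ‖y‖ ^ 2) m) (hK : ∫ y, ‖y‖ ^ 2 ∂m ≤ K)
    (hstat : stepLaw (driftStep T xs α) √α ν m = m)
    {Q q σ : E → ℝ} (hQ0 : ∀ t, 0 ≤ Q t) (hq0 : ∀ t, 0 ≤ q t) (hσ0 : ∀ t, 0 ≤ σ t)
    (hqC : ∀ t, q t ≤ C * ‖t‖ ^ 2) (hσV : ∀ t, σ t ≤ V * ‖t‖ ^ 2) (hV : 0 ≤ V) (hC : 0 ≤ C)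
    (hQ : ∀ t, Q (adjointStep L α t) = Q t - α * σ t + α ^ 2 * q t) {t : E} (ht : ‖t‖ ≤ r)
    (hε₂ : 0 ≤ ε₂)
    (hχ : ‖charFun ν (√α • t) - 1 + ((α * σ t / 2 : ℝ) : ℂ)‖ ≤ ε₂ * (α * ‖t‖ ^ 2))
    (hα1 : α * (V * r ^ 2) / 2 ≤ 1) :
    ‖charFun m t - (Real.exp (-Q t / 2) : ℂ)‖ ≤
      ‖charFun m (adjointStep L α t) - (Real.exp (-Q (adjointStep L α t) / 2) : ℂ)‖ +
      α * ‖t‖ * (ε * (1 + K) + √α * c' * K + ε₂ * r +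
        α * (V ^ 2 * r ^ 3 / 4 + C * r / 2)) := by
  have hΦ : Continuous (driftStep T xs α) := by unfold driftStep; fun_prop
  have hr0 : 0 ≤ r := (norm_nonneg t).trans ht
  have h1 := norm_integral_driftStep_sub_charFun_le hTc hxs hε hr hα.le m hm t
  have hdecomp : charFun m t = _ := (congrArg (charFun · t) hstat).symm.trans
    (charFun_stepLaw hΦ (√α) ν m t)
  rw [hdecomp]
  set a : ℝ := α * σ t / 2 with ha
  set b : ℝ := α ^ 2 * q t / 2 with hb
  have ha0 : 0 ≤ a := by have := hσ0 t; positivity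
  have hb0 : 0 ≤ b := by have := hq0 t; positivity
  -- One factor `‖t‖` is traded for `r`: every error must be linear in `‖t‖` to fit the telescoping
  -- estimate.
  have hσt : σ t ≤ V * (r * ‖t‖) := (hσV t).trans (by
    rw [sq]; gcongr)
  have haV : a ≤ α * (V * (r * ‖t‖)) / 2 := by rw [ha]; gcongr
  have ha1 : a ≤ 1 := haV.trans (le_trans (by rw [sq]; gcongr) hα1)
  have h4 : ‖((Real.exp (-Q (adjointStep L α t) / 2) : ℝ) : ℂ) * (1 - a) -
      (Real.exp (-Q t / 2) : ℝ)‖ ≤ a ^ 2 + b := by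
    have h5 : Real.exp (-Q (adjointStep L α t) / 2) =
        Real.exp (-Q t / 2) * Real.exp (a - b) := by
      rw [hQ, ← Real.exp_add]
      congr 1
      ring
    have h6 : Real.exp (-Q t / 2) ≤ 1 := Real.exp_le_one_iff.2 (by have := hQ0 t; linarith)
    have h7 := abs_exp_sub_mul_one_sub_sub_one_le ha0 ha1 hb0
    rw [← Complex.ofReal_one, ← Complex.ofReal_sub, ← Complex.ofReal_mul, ← Complex.ofReal_sub,
      Complex.norm_real, Real.norm_eq_abs, h5]
    rw [show Real.exp (-Q t / 2) * Real.exp (a - b) * (1 - a) - Real.exp (-Q t / 2) =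
      Real.exp (-Q t / 2) * (Real.exp (a - b) * (1 - a) - 1) by ring, abs_mul,
      abs_of_pos (Real.exp_pos _)]
    exact (mul_le_of_le_one_left (abs_nonneg _) h6).trans h7
  have h8 : a ^ 2 + b ≤ α * ‖t‖ * (α * (V ^ 2 * r ^ 3 / 4 + C * r / 2)) := by
    have h9 : a ^ 2 ≤ α * ‖t‖ * (α * (V ^ 2 * r ^ 3 / 4)) := by
      calc a ^ 2 ≤ (α * (V * (r * ‖t‖)) / 2) ^ 2 := by gcongr
        _ = α ^ 2 * V ^ 2 * r ^ 2 / 4 * ‖t‖ * ‖t‖ := by ring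
        _ ≤ α ^ 2 * V ^ 2 * r ^ 2 / 4 * ‖t‖ * r := by gcongr
        _ = _ := by ring
    have h10 : b ≤ α * ‖t‖ * (α * (C * r / 2)) := by
      calc b ≤ α ^ 2 * (C * ‖t‖ ^ 2) / 2 := by rw [hb]; gcongr; exact hqC t
        _ = α ^ 2 * C / 2 * ‖t‖ * ‖t‖ := by ring
        _ ≤ α ^ 2 * C / 2 * ‖t‖ * r := by gcongr
        _ = _ := by ring
    linarith
  have h11 : ε₂ * (α * ‖t‖ ^ 2) ≤ α * ‖t‖ * (ε₂ * r) := by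
    calc ε₂ * (α * ‖t‖ ^ 2) = α * ‖t‖ * (ε₂ * ‖t‖) := by ring
      _ ≤ _ := by gcongr
  have h12 : α * ‖t‖ * (ε * (1 + ∫ y, ‖y‖ ^ 2 ∂m) + √α * c' * ∫ y, ‖y‖ ^ 2 ∂m) ≤
      α * ‖t‖ * (ε * (1 + K) + √α * c' * K) := by gcongr
  refine (norm_mul_sub_le (w := charFun m (adjointStep L α t))
    (u := (Real.exp (-Q (adjointStep L α t) / 2) : ℝ)) (a := a) (norm_charFun_le_one _) ?_).trans ?_
  · rw [Complex.norm_real, Real.norm_eq_abs, abs_of_pos (Real.exp_pos _)]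
    exact Real.exp_le_one_iff.2 (by have := hQ0 (adjointStep L α t); linarith)
  · linarith

/-- The difference from `exp (-Q / 2)` is continuous and vanishes at `0`, and each step to
`adjointStep L α t` costs `α ‖t‖ o(1)`. The contraction rate `α (1 - γ)` of these steps in the norm
`‖D.symm t‖` compensates the factor `α`. -/
theorem tendsto_charFun_stationary {T : E → E} (hTc : Continuous T) {xs : E} (hxs : T xs = xs)
    {L : E →L[ℝ] E} (hTL : HasFDerivAt T L xs) {c : ℝ} (hc : ∀ y, ‖T y - T xs‖ ≤ c * ‖y - xs‖)
    {D : E ≃L[ℝ] E} {γ : ℝ} (hγ0 : 0 ≤ γ) (hγ1 : γ < 1)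
    (hL : ∀ t, ‖D.symm (ContinuousLinearMap.adjoint L t)‖ ≤ γ * ‖D.symm t‖)
    (ν : Measure E) [IsProbabilityMeasure ν]
    (hν : MemLp (fun v => v) 2 ν) (hν0 : ∫ v, v ∂ν = 0) {K : ℝ} (π : ℝ → ProbabilityMeasure E)
    (hstat : ∀ α ∈ Set.Ioo (0 : ℝ) 1, stepLaw (driftStep T xs α) √α ν (π α) = π α)
    (hint : ∀ α ∈ Set.Ioo (0 : ℝ) 1, Integrable (fun y => ‖y‖ ^ 2) (π α : Measure E))
    (hK : ∀ α ∈ Set.Ioo (0 : ℝ) 1, ∫ y, ‖y‖ ^ 2 ∂(π α : Measure E) ≤ K)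
    {Q q : E → ℝ} (hQc : Continuous Q) (hQz : Q 0 = 0) (hQ0 : ∀ t, 0 ≤ Q t)
    (hq0 : ∀ t, 0 ≤ q t) {C : ℝ} (hC : 0 ≤ C) (hqC : ∀ t, q t ≤ C * ‖t‖ ^ 2)
    (hQ : ∀ α t, Q (adjointStep L α t) = Q t - α * (∫ v, inner ℝ v t ^ 2 ∂ν) + α ^ 2 * q t)
    (t : E) :
    Tendsto (fun α => charFun (π α : Measure E) t) (𝓝[>] 0) (𝓝 (Real.exp (-Q t / 2) : ℂ)) := by
  have hK0 : 0 ≤ K := le_trans (integral_nonneg fun _ => by positivity) (hK (1 / 2) (by norm_num))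
  have hV0 : 0 ≤ ∫ v, ‖v‖ ^ 2 ∂ν := integral_nonneg fun _ => by positivity
  set V := ∫ v, ‖v‖ ^ 2 ∂ν
  set d : ℝ := ‖(D : E →L[ℝ] E)‖
  have hd : ∀ u, ‖u‖ ≤ d * ‖D.symm u‖ := fun u => by
    simpa using (D : E →L[ℝ] E).le_opNorm (D.symm u)
  have hd0 : 0 ≤ d := norm_nonneg _
  set r := d * ‖D.symm t‖
  have hr0 : 0 ≤ r := by positivity
  refine Metric.tendsto_nhds.2 fun ε₀ hε₀ => ?_
  -- The per-step error will be at most `α * ‖u‖ * η`, hence the total at most `η * r / (1 - γ) = ε₀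
  -- * r / (2 * (r + 1)) < ε₀`. The budget for `η` is a quarter for the linearization, a quarter for
  -- the noise expansion, and a half for the terms vanishing with `α`.
  set η := ε₀ * (1 - γ) / (2 * (r + 1)) with hη_def
  have h1γ : 0 < 1 - γ := sub_pos.2 hγ1
  have hη : 0 < η := by positivity
  obtain ⟨c', hc'0, hrem⟩ := exists_norm_sub_fderiv_le hTL hc
    (ε := η / (4 * (1 + K))) (by positivity)
  obtain ⟨δ, hδ, hχ⟩ := exists_norm_charFun_sub_le ν hν hν0 (ε := η / (4 * (r + 1)))
    (by positivity)
  have hlim : ∀ {f : ℝ → ℝ} {b : ℝ}, Continuous f → f 0 < b → ∀ᶠ α in 𝓝[>] (0 : ℝ), f α < b :=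
    fun hf hb => ((hf.tendsto 0).mono_left nhdsWithin_le_nhds).eventually_lt_const hb
  have e1 := hlim (f := fun α => √α * r) (b := δ) (by fun_prop) (by simpa)
  have e2 := hlim (f := fun α => α * (V * r ^ 2) / 2) (b := 1) (by fun_prop) (by simp)
  have e3 := hlim (f := fun α => √α * c' * K + α * (V ^ 2 * r ^ 3 / 4 + C * r / 2)) (b := η / 2)
    (by fun_prop) (by simpa)
  have e4 := hlim (f := fun α => α) (b := 1) (by fun_prop) (by norm_num)
  filter_upwards [e1, e2, e3, e4, self_mem_nhdsWithin] with α h1 h2 h3 h4 (hα : 0 < α)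
  have hαm : α ∈ Set.Ioo (0 : ℝ) 1 := ⟨hα, h4⟩
  have hρ : 1 - α * (1 - γ) < 1 := by have := mul_pos hα h1γ; linarith
  have hρ0 : 0 ≤ 1 - α * (1 - γ) := by nlinarith
  have hψ0 : Tendsto (fun u => ‖charFun (π α : Measure E) u - (Real.exp (-Q u / 2) : ℂ)‖)
      (𝓝 0) (𝓝 0) := by
    have hcont : Continuous fun u : E =>
        ‖charFun (π α : Measure E) u - (Real.exp (-Q u / 2) : ℂ)‖ := by
      have := continuous_charFun (μ := (π α : Measure E))
      fun_prop
    simpa [hQz] using hcont.tendsto 0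
  have hmain := le_mul_of_le_comp_add
    (h := fun u => ‖charFun (π α : Measure E) u - (Real.exp (-Q u / 2) : ℂ)‖)
    (n := fun u => ‖D.symm u‖) (B := adjointStep L α) (R := ‖D.symm t‖)
    (ρ := 1 - α * (1 - γ)) (c := d) (κ := η * d / (1 - γ)) (fun _ => norm_nonneg _) hd hρ0 hρ
    (fun u => ?_) hψ0 (by positivity) (fun u hu => ?_) le_rfl (t := t)
  · rw [dist_eq_norm]
    refine hmain.trans_lt ?_
    have : η * d / (1 - γ) * ‖D.symm t‖ = ε₀ * (r / (2 * (r + 1))) := by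
      rw [hη_def]
      field_simp
      rfl
    rw [this]
    refine mul_lt_of_lt_one_right hε₀ ?_
    rw [div_lt_one (by positivity)]
    linarith
  · have : adjointStep L α u = (1 - α) • u + α • ContinuousLinearMap.adjoint L u := by
      rw [adjointStep]; module
    simp only [this, map_add, map_smul]
    refine (norm_add_le _ _).trans ?_
    rw [norm_smul, norm_smul, Real.norm_eq_abs, Real.norm_eq_abs, abs_of_pos hα,
      abs_of_pos (by linarith)]
    have := mul_le_mul_of_nonneg_left (hL u) hα.le
    linarith
  · have hur : ‖u‖ ≤ r := (hd u).trans (mul_le_mul_of_nonneg_left hu hd0)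
    have hsm : ‖√α • u‖ = √α * ‖u‖ := by
      rw [norm_smul, Real.norm_eq_abs, abs_of_nonneg (Real.sqrt_nonneg α)]
    have hχu := hχ (√α • u) (by
      rw [hsm]
      exact (mul_le_mul_of_nonneg_left hur (Real.sqrt_nonneg α)).trans_lt h1)
    simp_rw [real_inner_smul_right, mul_pow, integral_const_mul, hsm, mul_pow,
      Real.sq_sqrt hα.le] at hχu
    have hstep := norm_charFun_sub_exp_le_step hTc hxs (by positivity) hc'0 hrem hα ν
      (π α : Measure E) (hint α hαm) (hK α hαm) (hstat α hαm) hQ0 hq0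
      (σ := fun t => ∫ v, inner ℝ v t ^ 2 ∂ν) (fun t => integral_nonneg fun _ => by positivity)
      hqC (integral_inner_sq_le ν hν) hV0 hC (hQ α) hur (by positivity) hχu h2.le
    refine hstep.trans (add_le_add_right ?_ _)
    have h5 : η / (4 * (1 + K)) * (1 + K) = η / 4 := by field_simp
    have h6 : η / (4 * (r + 1)) * r ≤ η / 4 := by
      rw [div_mul_eq_mul_div, div_le_div_iff₀ (by positivity) (by norm_num)]
      nlinarith
    calc _ ≤ α * ‖u‖ * η := by
          gcongr
          linarith
      _ ≤ α * (d * ‖D.symm u‖) * η := by gcongr; exact hd u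
      _ = η * d / (1 - γ) * (1 - (1 - α * (1 - γ))) * ‖D.symm u‖ := by
          field_simp
          ring

end StationaryCharFun

/-! ### The weighted norm as a rescaled Euclidean norm -/

section Weighted

variable {d : ℕ}

/-- The diagonal scaling by the square roots of the weights. -/
noncomputable def weightScale (μ : Fin d → ℝ) (hμ : ∀ i, 0 < μ i) :
    EuclideanSpace ℝ (Fin d) ≃L[ℝ] EuclideanSpace ℝ (Fin d) :=
  .equivOfInverse (Matrix.toEuclideanCLM (𝕜 := ℝ) (Matrix.diagonal fun i => √(μ i)))
    (Matrix.toEuclideanCLM (𝕜 := ℝ) (Matrix.diagonal fun i => (√(μ i))⁻¹))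
    (fun x => by
      ext i
      simp [Matrix.mulVec_diagonal, inv_mul_cancel_left₀ (Real.sqrt_pos.2 (hμ i)).ne'])
    (fun x => by
      ext i
      simp [Matrix.mulVec_diagonal, mul_inv_cancel_left₀ (Real.sqrt_pos.2 (hμ i)).ne'])

variable {μ : Fin d → ℝ} {hμ : ∀ i, 0 < μ i}

lemma weightScale_apply (x : EuclideanSpace ℝ (Fin d)) (i : Fin d) :
    weightScale μ hμ x i = √(μ i) * x i := by
  simp [weightScale, Matrix.mulVec_diagonal]

lemma weightedNorm_eq (x : EuclideanSpace ℝ (Fin d)) :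
    weightedNorm μ x = ‖weightScale μ hμ x‖ := by
  rw [weightedNorm, EuclideanSpace.norm_eq]
  congr 1
  refine Finset.sum_congr rfl fun i _ => ?_
  rw [weightScale_apply, Real.norm_eq_abs, sq_abs, mul_pow, Real.sq_sqrt (hμ i).le]

lemma inner_weightScale_left (x y : EuclideanSpace ℝ (Fin d)) :
    inner ℝ (weightScale μ hμ x) y = inner ℝ x (weightScale μ hμ y) := by
  simp only [PiLp.inner_apply, weightScale_apply]
  refine Finset.sum_congr rfl fun i _ => ?_
  simp
  ring

end Weighted

/-! ### Contraction of the derivative, its adjoint and the drift -/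

section Contraction

variable {E : Type*} [NormedAddCommGroup E] [InnerProductSpace ℝ E] [FiniteDimensional ℝ E]
  {D : E ≃L[ℝ] E} {γ : ℝ}

/-- The contraction bound holds for difference quotients and passes to the limit. -/
lemma norm_map_fderiv_le {T : E → E} {L : E →L[ℝ] E} {xs : E} (hTL : HasFDerivAt T L xs)
    (hT : ∀ x y, ‖D (T x - T y)‖ ≤ γ * ‖D (x - y)‖) (x : E) : ‖D (L x)‖ ≤ γ * ‖D x‖ := by
  have h := hTL.hasLineDerivAt x
  have h1 : Tendsto (fun s : ℝ => ‖D (s⁻¹ • (T (xs + s • x) - T xs))‖) (𝓝[≠] 0) (𝓝 ‖D (L x)‖) :=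
    ((D.continuous.tendsto _).comp h.tendsto_slope_zero).norm
  refine le_of_tendsto h1 ?_
  filter_upwards [self_mem_nhdsWithin] with s (hs : s ≠ 0)
  rw [map_smul, norm_smul, norm_inv, inv_mul_le_iff₀ (by positivity)]
  refine (hT _ _).trans ?_
  rw [add_sub_cancel_left, map_smul, norm_smul]
  exact le_of_eq (by ring)

/-- Duality: for self-adjoint `D` the norm `‖D.symm t‖` is dual to `‖D x‖`, and an adjoint has the
same operator norm for the dual norms. -/
lemma norm_symm_adjoint_le (hD : ∀ x y, inner ℝ (D x) y = inner ℝ x (D y)) {L : E →L[ℝ] E}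
    (hL : ∀ x, ‖D (L x)‖ ≤ γ * ‖D x‖) (t : E) :
    ‖D.symm (ContinuousLinearMap.adjoint L t)‖ ≤ γ * ‖D.symm t‖ := by
  set u := D.symm (ContinuousLinearMap.adjoint L t) with hu
  have h1 : ‖u‖ * ‖u‖ ≤ (γ * ‖D.symm t‖) * ‖u‖ := by
    calc ‖u‖ * ‖u‖ = inner ℝ u u := (real_inner_self_eq_norm_mul_norm u).symm
      _ = inner ℝ u (D (D.symm u)) := by rw [D.apply_symm_apply]
      _ = inner ℝ (D.symm t) (D (L (D.symm u))) := by
          rw [← hD, hu, D.apply_symm_apply, ContinuousLinearMap.adjoint_inner_left, ← hu, ← hD,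
            D.apply_symm_apply]
      _ ≤ ‖D.symm t‖ * ‖D (L (D.symm u))‖ := real_inner_le_norm _ _
      _ ≤ ‖D.symm t‖ * (γ * ‖D (D.symm u)‖) := by gcongr; exact hL _
      _ = _ := by rw [D.apply_symm_apply]; ring
  rcases (norm_nonneg u).eq_or_lt with h0 | h0
  -- The sign of `γ` is not assumed; a negative right-hand side would contradict `hL` at `D.symm
  -- (D.symm t)`.
  · rw [← h0]
    by_contra! hneg
    have h2 := hL (D.symm (D.symm t))
    rw [D.apply_symm_apply] at h2
    have := norm_nonneg (D (L (D.symm (D.symm t))))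
    linarith
  · exact le_of_mul_le_mul_right h1 h0

lemma norm_map_driftStep_sub_le {T : E → E} (hT : ∀ x y, ‖D (T x - T y)‖ ≤ γ * ‖D (x - y)‖)
    (xs : E) {α : ℝ} (hα0 : 0 ≤ α) (hα1 : α ≤ 1) (x y : E) :
    ‖D (driftStep T xs α x - driftStep T xs α y)‖ ≤ (1 - α * (1 - γ)) * ‖D (x - y)‖ := by
  have hs : α = √α * √α := (Real.mul_self_sqrt hα0).symm
  have h : driftStep T xs α x - driftStep T xs α y =
      (1 - α) • (x - y) + √α • (T (√α • x + xs) - T (√α • y + xs)) := by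
    simp only [driftStep]
    generalize √α = s at *
    subst hs
    module
  have h2 := hT (√α • x + xs) (√α • y + xs)
  rw [add_sub_add_right_eq_sub, ← smul_sub, map_smul, norm_smul, Real.norm_eq_abs,
    abs_of_nonneg (Real.sqrt_nonneg α)] at h2
  rw [h, map_add, map_smul, map_smul]
  refine (norm_add_le _ _).trans ?_
  rw [norm_smul, norm_smul, Real.norm_eq_abs, Real.norm_eq_abs,
    abs_of_nonneg (Real.sqrt_nonneg α), abs_of_nonneg (sub_nonneg.2 hα1)]
  have h3 := mul_le_mul_of_nonneg_left h2 (Real.sqrt_nonneg α)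
  have h4 : √α * (γ * (√α * ‖D (x - y)‖)) = α * γ * ‖D (x - y)‖ := by
    conv_rhs => rw [hs]
    ring
  linarith

end Contraction

/-! ### Laws of the scaled iterates -/

section IterateLaw

variable {d : ℕ} {Ω : Type*} [MeasurableSpace Ω] {P : Measure Ω} [IsProbabilityMeasure P]
  {w : ℕ → Ω → EuclideanSpace ℝ (Fin d)}

/-- State `k` depends only on the noise with index below `k`, which makes it independent of `w k`.
-/
lemma exists_scaledIterate_eq {T : EuclideanSpace ℝ (Fin d) → EuclideanSpace ℝ (Fin d)}
    (hT : Measurable T) (xs x₀ : EuclideanSpace ℝ (Fin d)) {α : ℝ} (hα : 0 < α) (k : ℕ) :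
    ∃ g : (Finset.range k → EuclideanSpace ℝ (Fin d)) → EuclideanSpace ℝ (Fin d), Measurable g ∧
      ∀ ω, scaledIterate T xs w x₀ α k ω = g fun i => w i ω := by
  induction k with
  | zero => exact ⟨fun _ => (√α)⁻¹ • (x₀ - xs), measurable_const, fun ω => rfl⟩
  | succ k ih =>
    obtain ⟨g, hg, h⟩ := ih
    let ρ : (Finset.range (k + 1) → EuclideanSpace ℝ (Fin d)) →
        (Finset.range k → EuclideanSpace ℝ (Fin d)) :=
      fun v i => v ⟨i, Finset.mem_range.2 ((Finset.mem_range.1 i.2).trans k.lt_succ_self)⟩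
    have hρ : Measurable ρ := measurable_pi_lambda _ fun i => measurable_pi_apply _
    refine ⟨fun v => scaledStep T xs α (g (ρ v)) (v ⟨k, Finset.self_mem_range_succ k⟩), ?_,
      fun ω => ?_⟩
    · have h1 : Measurable fun v => g (ρ v) := hg.comp hρ
      unfold scaledStep
      fun_prop
    · rw [scaledIterate_succ T xs w x₀ hα, h]

lemma map_scaledIterate (hw_meas : ∀ k, Measurable (w k)) (hw_indep : iIndepFun w P)
    (hw_ident : ∀ k, IdentDistrib (w k) (w 0) P P)
    {T : EuclideanSpace ℝ (Fin d) → EuclideanSpace ℝ (Fin d)} (hT : Continuous T)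
    (xs x₀ : EuclideanSpace ℝ (Fin d)) {α : ℝ} (hα : 0 < α) (k : ℕ) :
    Measurable (scaledIterate T xs w x₀ α k) ∧
    P.map (scaledIterate T xs w x₀ α k) =
      (stepLaw (driftStep T xs α) √α (P.map (w 0)))^[k]
        (Measure.dirac ((√α)⁻¹ • (x₀ - xs))) := by
  have hΦ : Continuous (driftStep T xs α) := by unfold driftStep; fun_prop
  induction k with
  | zero =>
    refine ⟨(measurable_const : Measurable fun _ : Ω => (√α)⁻¹ • (x₀ - xs)), ?_⟩
    change P.map (fun _ => (√α)⁻¹ • (x₀ - xs)) = _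
    simp [Measure.map_const]
  | succ k ih =>
    obtain ⟨hm, ih⟩ := ih
    have hstep : scaledIterate T xs w x₀ α (k + 1) =
        (fun p : EuclideanSpace ℝ (Fin d) × EuclideanSpace ℝ (Fin d) =>
          driftStep T xs α p.1 + √α • p.2) ∘
          fun ω => (scaledIterate T xs w x₀ α k ω, w k ω) := by
      ext1 ω
      rw [scaledIterate_succ T xs w x₀ hα]
      rfl
    have hpair : Measurable fun ω => (scaledIterate T xs w x₀ α k ω, w k ω) :=
      hm.prodMk (hw_meas k)
    have hind : IndepFun (scaledIterate T xs w x₀ α k) (w k) P := by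
      obtain ⟨g, hg, h⟩ := exists_scaledIterate_eq (w := w) hT.measurable xs x₀ hα k
      have h1 := hw_indep.indepFun_finset (Finset.range k) {k} (by simp) hw_meas
      have h2 := h1.comp hg (measurable_pi_apply (⟨k, Finset.mem_singleton_self k⟩ :
        ({k} : Finset ℕ)))
      have h3 : scaledIterate T xs w x₀ α k = g ∘ fun ω (i : Finset.range k) => w i ω :=
        funext h
      rw [h3]
      exact h2
    refine ⟨hstep ▸ (measurable_step hΦ _).comp hpair, ?_⟩
    rw [hstep, ← Measure.map_map (measurable_step hΦ _) hpair,
      (indepFun_iff_map_prod_eq_prod_map_map hm.aemeasurable (hw_meas k).aemeasurable).1 hind,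
      ih, (hw_ident k).map_eq, Function.iterate_succ_apply']
    rfl

end IterateLaw

/-! ### The Lyapunov equation for a contraction -/

section Lyapunov

variable {E : Type*} [NormedAddCommGroup E] [InnerProductSpace ℝ E] [FiniteDimensional ℝ E]
  {D : E ≃L[ℝ] E} {γ : ℝ}

omit [FiniteDimensional ℝ E] in
-- For `M = D S D`, both terms on the left of `hS` have norm at most `γ * ‖M‖` after conjugation,
-- while the right side has norm `2 * ‖M‖`. Hence `‖M‖ ≤ γ * ‖M‖`.
lemma eq_zero_of_lyapunov_homogeneous (hγ0 : 0 ≤ γ) (hγ1 : γ < 1) {L L' S : E →L[ℝ] E}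
    (hL : ∀ x, ‖D (L x)‖ ≤ γ * ‖D x‖) (hL' : ∀ x, ‖D.symm (L' x)‖ ≤ γ * ‖D.symm x‖)
    (hS : ∀ x, L (S x) + S (L' x) = (2 : ℝ) • S x) : S = 0 := by
  set M : E →L[ℝ] E := (D : E →L[ℝ] E) ∘L S ∘L (D : E →L[ℝ] E) with hM
  have hMx : ∀ x, M x = D (S (D x)) := fun x => rfl
  have h1 : ‖M‖ ≤ γ * ‖M‖ := by
    refine M.opNorm_le_bound (by positivity) fun x => ?_
    have h2 : ‖D (L (S (D x)))‖ ≤ γ * (‖M‖ * ‖x‖) := by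
      refine (hL _).trans ?_
      rw [← hMx]
      gcongr
      exact M.le_opNorm x
    have h3 : ‖D (S (L' (D x)))‖ ≤ ‖M‖ * (γ * ‖x‖) := by
      have h4 := hL' (D x)
      rw [D.symm_apply_apply] at h4
      have h5 := M.le_opNorm (D.symm (L' (D x)))
      rw [hMx, D.apply_symm_apply] at h5
      exact h5.trans (by gcongr)
    have h6 := congrArg D (hS (D x))
    rw [map_add, map_smul, ← hMx] at h6
    have h7 := norm_add_le (D (L (S (D x)))) (D (S (L' (D x))))
    rw [h6, norm_smul, Real.norm_two] at h7
    linarith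
  have h2 : M = 0 := norm_eq_zero.1 (le_antisymm (by nlinarith [norm_nonneg M]) (norm_nonneg M))
  ext x
  have h3 : D (S (D (D.symm x))) = 0 := by rw [← hMx, h2]; rfl
  rw [D.apply_symm_apply] at h3
  simpa using h3

/-- Diagonalize the symmetric map `D S D`. For a unit eigenvector `b` with eigenvalue `l`, `hneg` at
`D b` reads `l * (⟪b, D L D⁻¹ b⟫ - 1) < 0`. The inner product is at most `γ < 1`, so `l > 0`. -/
lemma inner_pos_of_lyapunov (hD : ∀ x y, inner ℝ (D x) y = inner ℝ x (D y)) (hγ1 : γ < 1)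
    {L S : E →L[ℝ] E} (hL : ∀ x, ‖D (L x)‖ ≤ γ * ‖D x‖)
    (hS : ∀ x y, inner ℝ (S x) y = inner ℝ x (S y))
    (hneg : ∀ x, x ≠ 0 → inner ℝ x (L (S x)) - inner ℝ x (S x) < 0) {x : E} (hx : x ≠ 0) :
    0 < inner ℝ x (S x) := by
  let M : E →ₗ[ℝ] E := (D : E →L[ℝ] E) ∘L S ∘L (D : E →L[ℝ] E)
  have hMx : ∀ x, M x = D (S (D x)) := fun x => rfl
  have hM : M.IsSymmetric := fun x y => by rw [hMx, hMx, hD, hS, hD]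
  set b := hM.eigenvectorBasis rfl
  set l := hM.eigenvalues rfl
  have hb : ∀ i, M (b i) = l i • b i := fun i => by
    exact hM.apply_eigenvectorBasis rfl i
  have hl : ∀ i, 0 < l i := fun i => by
    have hbn : ‖b i‖ = 1 := b.norm_eq_one i
    have hb0 : D (b i) ≠ 0 := by
      rw [Ne, D.map_eq_zero_iff, ← norm_eq_zero, hbn]
      exact one_ne_zero
    have h1 := hneg _ hb0
    have h2 : S (D (b i)) = l i • D.symm (b i) := by
      rw [← map_smul, ← hb, hMx, D.symm_apply_apply]
    have h3 : inner ℝ (b i) (D (L (D.symm (b i)))) ≤ γ := by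
      refine (real_inner_le_norm _ _).trans ?_
      have := hL (D.symm (b i))
      rw [D.apply_symm_apply, hbn, mul_one] at this
      rwa [hbn, one_mul]
    rw [h2, map_smul, real_inner_smul_right, real_inner_smul_right, hD, hD, D.apply_symm_apply,
      real_inner_self_eq_norm_sq, hbn] at h1
    nlinarith
  have hz : x = D (D.symm x) := (D.apply_symm_apply x).symm
  set z := D.symm x
  have hz0 : z ≠ 0 := fun h => hx (by rw [hz, h, map_zero])
  have hsum : inner ℝ x (S x) = ∑ i, l i * inner ℝ (b i) z ^ 2 := by
    rw [hz, hD, ← hMx, ← b.sum_inner_mul_inner z (M z)]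
    refine Finset.sum_congr rfl fun i _ => ?_
    rw [← hM, hb, real_inner_smul_left, real_inner_comm]
    ring
  rw [hsum]
  refine Finset.sum_pos' (fun i _ => mul_nonneg (hl i).le (sq_nonneg _)) ?_
  by_contra! h
  refine hz0 (InnerProductSpace.ext_inner_left_basis b.toBasis fun i => ?_)
  have h1 := h i (Finset.mem_univ i)
  have h2 : inner ℝ (b i) z ^ 2 = 0 :=
    le_antisymm (by by_contra! h3; exact absurd h1 (not_le.2 (mul_pos (hl i) h3))) (sq_nonneg _)
  simpa using h2

end Lyapunov

/-! ### The Lyapunov equation for matrices -/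

section LyapunovMatrix

variable {d : ℕ} {D : EuclideanSpace ℝ (Fin d) ≃L[ℝ] EuclideanSpace ℝ (Fin d)} {γ : ℝ}

lemma toEuclideanCLM_transpose (A : Matrix (Fin d) (Fin d) ℝ) :
    Matrix.toEuclideanCLM (𝕜 := ℝ) Aᵀ =
      ContinuousLinearMap.adjoint (Matrix.toEuclideanCLM (𝕜 := ℝ) A) := by
  rw [← Matrix.conjTranspose_eq_transpose_of_trivial, ← Matrix.star_eq_conjTranspose, map_star]
  rfl

lemma toEuclideanCLM_mul_apply (A B : Matrix (Fin d) (Fin d) ℝ) (x : EuclideanSpace ℝ (Fin d)) :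
    Matrix.toEuclideanCLM (𝕜 := ℝ) (A * B) x =
      Matrix.toEuclideanCLM (𝕜 := ℝ) A (Matrix.toEuclideanCLM (𝕜 := ℝ) B x) := by
  rw [map_mul]
  rfl

lemma toEuclideanCLM_add_apply (A B : Matrix (Fin d) (Fin d) ℝ) (x : EuclideanSpace ℝ (Fin d)) :
    Matrix.toEuclideanCLM (𝕜 := ℝ) (A + B) x =
      Matrix.toEuclideanCLM (𝕜 := ℝ) A x + Matrix.toEuclideanCLM (𝕜 := ℝ) B x := by
  rw [map_add]
  rfl

lemma toEuclideanCLM_sub_apply (A B : Matrix (Fin d) (Fin d) ℝ) (x : EuclideanSpace ℝ (Fin d)) :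
    Matrix.toEuclideanCLM (𝕜 := ℝ) (A - B) x =
      Matrix.toEuclideanCLM (𝕜 := ℝ) A x - Matrix.toEuclideanCLM (𝕜 := ℝ) B x := by
  rw [map_sub]
  rfl

lemma solvesLyapunov_inner {J C S : Matrix (Fin d) (Fin d) ℝ} (hS : SolvesLyapunov (J - 1) C S)
    (t : EuclideanSpace ℝ (Fin d)) :
    inner ℝ t (Matrix.toEuclideanCLM (𝕜 := ℝ) J (Matrix.toEuclideanCLM (𝕜 := ℝ) S t)) +
      inner ℝ t (Matrix.toEuclideanCLM (𝕜 := ℝ) S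
        (ContinuousLinearMap.adjoint (Matrix.toEuclideanCLM (𝕜 := ℝ) J) t)) -
      2 * inner ℝ t (Matrix.toEuclideanCLM (𝕜 := ℝ) S t) +
      inner ℝ t (Matrix.toEuclideanCLM (𝕜 := ℝ) C t) = 0 := by
  have h1 := congrArg (fun A => inner ℝ t (Matrix.toEuclideanCLM (𝕜 := ℝ) A t)) hS
  have h0 : Matrix.toEuclideanCLM (𝕜 := ℝ) (0 : Matrix (Fin d) (Fin d) ℝ) t = 0 := by
    rw [map_zero]
    rfl
  simp only [Matrix.transpose_sub, Matrix.transpose_one, sub_mul, mul_sub, one_mul, mul_one, h0,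
    toEuclideanCLM_add_apply, toEuclideanCLM_sub_apply, toEuclideanCLM_mul_apply,
    inner_add_right, inner_sub_right, inner_zero_right, toEuclideanCLM_transpose] at h1
  linarith

/-- The Lyapunov equation of a matrix `J - 1`, with `J` contractive, has exactly one solution. It is
positive definite if the right hand side is. -/
lemma exists_solvesLyapunov (hD : ∀ x y, inner ℝ (D x) y = inner ℝ x (D y)) (hγ0 : 0 ≤ γ)
    (hγ1 : γ < 1) {J C : Matrix (Fin d) (Fin d) ℝ}
    (hJ : ∀ x, ‖D (Matrix.toEuclideanCLM (𝕜 := ℝ) J x)‖ ≤ γ * ‖D x‖) (hC : C.PosDef) :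
    ∃ S, S.PosDef ∧ SolvesLyapunov (J - 1) C S ∧ ∀ S', SolvesLyapunov (J - 1) C S' → S' = S := by
  have hJ' := norm_symm_adjoint_le hD hJ
  rw [← toEuclideanCLM_transpose] at hJ'
  let ℓ : Matrix (Fin d) (Fin d) ℝ →ₗ[ℝ] Matrix (Fin d) (Fin d) ℝ :=
    LinearMap.mulLeft ℝ (J - 1) + LinearMap.mulRight ℝ (J - 1)ᵀ
  have hℓ : ∀ S, ℓ S = (J - 1) * S + S * (J - 1)ᵀ := fun S => rfl
  have hinj : Function.Injective ℓ := by
    refine (injective_iff_map_eq_zero ℓ).2 fun S hS => ?_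
    rw [hℓ, Matrix.transpose_sub, Matrix.transpose_one] at hS
    have h1 : J * S + S * Jᵀ = (2 : ℝ) • S := by
      have : J * S + S * Jᵀ = ((J - 1) * S + S * (Jᵀ - 1)) + (2 : ℝ) • S := by
        rw [sub_mul, mul_sub, two_smul]; simp only [one_mul, mul_one]; abel
      rw [this, hS, zero_add]
    have h2 := eq_zero_of_lyapunov_homogeneous hγ0 hγ1 hJ hJ'
      (S := Matrix.toEuclideanCLM (𝕜 := ℝ) S) fun x => by
        have := congrArg (fun A => Matrix.toEuclideanCLM (𝕜 := ℝ) A x) h1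
        simp only [toEuclideanCLM_add_apply, toEuclideanCLM_mul_apply, map_smul] at this
        exact this
    exact (map_eq_zero_iff _ (Matrix.toEuclideanCLM (𝕜 := ℝ) (n := Fin d)).injective).1 h2
  -- In finite dimension, uniqueness for the homogeneous equation gives existence.
  obtain ⟨S, hS⟩ := (LinearMap.injective_iff_surjective.1 hinj) (-C)
  have hiff : ∀ S', SolvesLyapunov (J - 1) C S' ↔ ℓ S' = -C := fun S' => by
    rw [SolvesLyapunov, hℓ, eq_neg_iff_add_eq_zero]
  have huniq : ∀ S', SolvesLyapunov (J - 1) C S' → S' = S := fun S' h =>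
    hinj (((hiff S').1 h).trans hS.symm)
  -- As `C` is symmetric, `Sᵀ` solves the same equation.
  have hST : Sᵀ = S := by
    refine hinj (Eq.trans ?_ hS.symm)
    have h1 := congrArg Matrix.transpose hS
    have h2 : Cᵀ = C := hC.isHermitian
    rw [hℓ, Matrix.transpose_add, Matrix.transpose_mul, Matrix.transpose_mul,
      Matrix.transpose_transpose, Matrix.transpose_neg, h2] at h1
    rw [hℓ, add_comm, h1]
  have hSsymm : ∀ x y, inner ℝ (Matrix.toEuclideanCLM (𝕜 := ℝ) S x) y =
      inner ℝ x (Matrix.toEuclideanCLM (𝕜 := ℝ) S y) := fun x y => by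
    conv_rhs => rw [← hST, toEuclideanCLM_transpose]
    rw [ContinuousLinearMap.adjoint_inner_right]
  refine ⟨S, ?_, (hiff S).2 hS, huniq⟩
  have hCpos : ∀ x : EuclideanSpace ℝ (Fin d), x ≠ 0 →
      0 < inner ℝ x (Matrix.toEuclideanCLM (𝕜 := ℝ) C x) := fun x hx => by
    rw [Matrix.inner_toEuclideanCLM]
    simpa using hC.dotProduct_mulVec_pos (x := x.ofLp) (by simpa using hx)
  refine .of_dotProduct_mulVec_pos (by
    rw [Matrix.IsHermitian, Matrix.conjTranspose_eq_transpose_of_trivial, hST]) fun x hx => ?_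
  have hmain := inner_pos_of_lyapunov hD hγ1 hJ hSsymm (fun y hy => ?_)
    (x := WithLp.toLp 2 x) (by simpa using hx)
  · rw [Matrix.inner_toEuclideanCLM] at hmain
    simpa using hmain
  · have h1 := solvesLyapunov_inner ((hiff S).2 hS) y
    rw [← hSsymm y (ContinuousLinearMap.adjoint _ y),
      ContinuousLinearMap.adjoint_inner_right, real_inner_comm] at h1
    have h2 := real_inner_comm y (Matrix.toEuclideanCLM (𝕜 := ℝ) J
      (Matrix.toEuclideanCLM (𝕜 := ℝ) S y))
    have := hCpos y hy
    linarith

/-- The Lyapunov equation is exactly the statement that the first-order term in `α` is `-⟪t, C t⟫`;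
the second-order term is nonnegative when `S` is positive semidefinite. -/
lemma inner_adjointStep {J C S : Matrix (Fin d) (Fin d) ℝ} (hS : SolvesLyapunov (J - 1) C S)
    (α : ℝ) (t : EuclideanSpace ℝ (Fin d)) :
    let L := Matrix.toEuclideanCLM (𝕜 := ℝ) J
    let z := ContinuousLinearMap.adjoint L t - t
    inner ℝ (adjointStep L α t) (Matrix.toEuclideanCLM (𝕜 := ℝ) S (adjointStep L α t)) =
      inner ℝ t (Matrix.toEuclideanCLM (𝕜 := ℝ) S t) -
        α * inner ℝ t (Matrix.toEuclideanCLM (𝕜 := ℝ) C t) +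
        α ^ 2 * inner ℝ z (Matrix.toEuclideanCLM (𝕜 := ℝ) S z) := by
  intro L z
  have h1 := solvesLyapunov_inner hS t
  rw [← ContinuousLinearMap.adjoint_inner_left] at h1
  have h2 : adjointStep L α t = t + α • z := rfl
  have h3 : inner ℝ z (Matrix.toEuclideanCLM (𝕜 := ℝ) S t) +
      inner ℝ t (Matrix.toEuclideanCLM (𝕜 := ℝ) S z) =
      - inner ℝ t (Matrix.toEuclideanCLM (𝕜 := ℝ) C t) := by
    simp only [z, L, inner_sub_left, map_sub, inner_sub_right]
    linarith
  rw [h2]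
  simp only [map_add, map_smul, inner_add_left, inner_add_right, real_inner_smul_left,
    real_inner_smul_right]
  linear_combination α * h3

end LyapunovMatrix

/-! ### The limit equation, the covariance form and the Jacobian -/

section LimitEquation

variable {d : ℕ}

lemma hasDerivAt_charFun_line {E : Type*} [NormedAddCommGroup E] [InnerProductSpace ℝ E]
    [FiniteDimensional ℝ E] [MeasurableSpace E] [BorelSpace E] (m : Measure E)
    [IsProbabilityMeasure m] (hm : Integrable (fun y => y) m) (t z : E) :
    Integrable (fun y => ((inner ℝ y z : ℝ) : ℂ) * Complex.I *
      Complex.exp ((inner ℝ y t : ℝ) * Complex.I)) m ∧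
    HasDerivAt (fun s : ℝ => charFun m (t + s • z))
      (∫ y, ((inner ℝ y z : ℝ) : ℂ) * Complex.I *
        Complex.exp ((inner ℝ y t : ℝ) * Complex.I) ∂m) 0 := by
  have h := hasDerivAt_integral_of_dominated_loc_of_deriv_le (μ := m) (x₀ := (0 : ℝ))
    (s := Set.univ) (bound := fun y => ‖y‖ * ‖z‖)
    (F := fun s y => Complex.exp ((inner ℝ y (t + s • z) : ℝ) * Complex.I))
    (F' := fun s y => ((inner ℝ y z : ℝ) : ℂ) * Complex.I *
      Complex.exp ((inner ℝ y (t + s • z) : ℝ) * Complex.I)) Filter.univ_mem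
    (.of_forall fun s => by fun_prop)
    (.of_bound (by fun_prop) 1 (.of_forall fun v => by rw [Complex.norm_exp_ofReal_mul_I]))
    (by fun_prop) (.of_forall fun y s _ => ?_) (hm.norm.mul_const _)
    (.of_forall fun y s _ => ?_)
  · simpa [charFun_apply] using h
  · rw [norm_mul, Complex.norm_exp_ofReal_mul_I, norm_mul, Complex.norm_I, Complex.norm_real,
      mul_one, mul_one]
    exact norm_inner_le_norm y z
  · have h1 : HasDerivAt (fun s : ℝ => inner ℝ y (t + s • z)) (inner ℝ y z) s := by
      simp_rw [inner_add_right, real_inner_smul_right]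
      simpa using ((hasDerivAt_id s).mul_const (inner ℝ y z)).const_add (inner ℝ y t)
    have h2 := (h1.ofReal_comp.mul_const Complex.I).cexp
    rwa [mul_comm] at h2

/-- The characteristic function is differentiated at `t` in the direction `z = (J - 1)ᵀ t` in two
ways: under the integral, which produces the term linear in `Y`, and in the Gaussian formula, where
the Lyapunov equation yields `⟪t, C t⟫ / 2` times its value. -/
lemma solvesLimitEquation_of_charFun {J C S : Matrix (Fin d) (Fin d) ℝ}
    (hS : SolvesLyapunov (J - 1) C S) (m : Measure (EuclideanSpace ℝ (Fin d)))
    [IsProbabilityMeasure m] (hm : Integrable (fun y => y) m)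
    (hchar : ∀ t, charFun m t =
      (Real.exp (-(inner ℝ t (Matrix.toEuclideanCLM (𝕜 := ℝ) S t)) / 2) : ℂ)) :
    SolvesLimitEquation C (J - 1) m := by
  intro t
  set L := Matrix.toEuclideanCLM (𝕜 := ℝ) J with hL
  set z := ContinuousLinearMap.adjoint L t - t with hz
  set σ := inner ℝ t (Matrix.toEuclideanCLM (𝕜 := ℝ) C t) with hσ
  obtain ⟨hint, hder⟩ := hasDerivAt_charFun_line m hm t z
  have hder2 : HasDerivAt (fun s : ℝ => charFun m (t + s • z))
      ((σ / 2 : ℝ) * charFun m t) 0 := by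
    have h1 : ∀ s : ℝ, charFun m (t + s • z) =
        (Real.exp (-(inner ℝ t (Matrix.toEuclideanCLM (𝕜 := ℝ) S t) - s * σ +
          s ^ 2 * inner ℝ z (Matrix.toEuclideanCLM (𝕜 := ℝ) S z)) / 2) : ℂ) := fun s => by
      rw [hchar]
      exact congrArg (fun x : ℝ => ((Real.exp (-x / 2) : ℝ) : ℂ)) (inner_adjointStep hS s t)
    simp_rw [h1]
    rw [hchar, ← Complex.ofReal_mul]
    refine HasDerivAt.ofReal_comp ?_
    generalize inner ℝ t (Matrix.toEuclideanCLM (𝕜 := ℝ) S t) = a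
    generalize inner ℝ z (Matrix.toEuclideanCLM (𝕜 := ℝ) S z) = b
    have h2 : HasDerivAt (fun s : ℝ => -(a - s * σ + s ^ 2 * b) / 2) (σ / 2) 0 := by
      have h3 := (((((hasDerivAt_id (0 : ℝ)).mul_const σ).const_sub a).add
        ((hasDerivAt_pow 2 (0 : ℝ)).mul_const b)).neg).div_const 2
      convert! h3 using 1
      simp
    convert! h2.exp using 1
    simp
    ring
  have heq := hder.unique hder2
  have hfun : limitIntegrand C (J - 1) t = fun y =>
      (σ : ℂ) * Complex.exp ((inner ℝ y t : ℝ) * Complex.I) -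
        2 * (((inner ℝ y z : ℝ) : ℂ) * Complex.I *
          Complex.exp ((inner ℝ y t : ℝ) * Complex.I)) := by
    ext1 y
    have h1 : t.ofLp ⬝ᵥ (J - 1) *ᵥ y.ofLp = inner ℝ y z := by
      rw [← Matrix.inner_toEuclideanCLM, toEuclideanCLM_sub_apply, map_one, inner_sub_right, hz,
        inner_sub_right, ContinuousLinearMap.adjoint_inner_right, real_inner_comm t (L y),
        real_inner_comm t y]
      rfl
    have h2 : t.ofLp ⬝ᵥ y.ofLp = inner ℝ y t := by
      simp [EuclideanSpace.inner_eq_star_dotProduct]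
    rw [limitIntegrand, h1, h2, ← Matrix.inner_toEuclideanCLM]
    rw [mul_comm Complex.I]
    ring
  have hexp : Integrable (fun y => Complex.exp ((inner ℝ y t : ℝ) * Complex.I)) m :=
    .of_bound (by fun_prop) 1 (.of_forall fun v => by rw [Complex.norm_exp_ofReal_mul_I])
  rw [hfun]
  refine ⟨(hexp.const_mul _).sub (hint.const_mul 2), ?_⟩
  rw [integral_sub (hexp.const_mul _) (hint.const_mul 2), integral_const_mul, integral_const_mul,
    heq, ← charFun_apply]
  push_cast
  ring

lemma integral_inner_sq_eq {Ω : Type*} [MeasurableSpace Ω] (P : Measure Ω)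
    [IsProbabilityMeasure P] {X : Ω → EuclideanSpace ℝ (Fin d)} (hX : MemLp X 2 P)
    (hX0 : ∫ ω, X ω ∂P = 0) {C : Matrix (Fin d) (Fin d) ℝ}
    (hC : ∀ i j, C i j = cov[fun ω => X ω i, fun ω => X ω j; P])
    (t : EuclideanSpace ℝ (Fin d)) :
    ∫ ω, inner ℝ (X ω) t ^ 2 ∂P = inner ℝ t (Matrix.toEuclideanCLM (𝕜 := ℝ) C t) := by
  have hi : ∀ i, MemLp (fun ω => t i * X ω i) 2 P := fun i =>
    ((EuclideanSpace.proj (𝕜 := ℝ) i).comp_memLp' hX).const_mul (t i)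
  have hXi : Integrable X P := hX.integrable (by norm_num)
  have hinner : ∀ ω, inner ℝ (X ω) t = ∑ i, t i * X ω i := fun ω => by
    simp [PiLp.inner_apply]
  have hmean : ∫ ω, inner ℝ (X ω) t ∂P = 0 := by
    simp_rw [real_inner_comm t]
    rw [integral_inner hXi, hX0, inner_zero_right]
  have hvar : Var[fun ω => inner ℝ (X ω) t; P] = ∫ ω, inner ℝ (X ω) t ^ 2 ∂P :=
    variance_of_integral_eq_zero (hXi.inner_const t).aemeasurable hmean
  rw [← hvar, ← covariance_self (hXi.inner_const t).aemeasurable]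
  simp_rw [hinner]
  rw [covariance_fun_sum_fun_sum hi hi, Matrix.inner_toEuclideanCLM]
  simp only [dotProduct, Matrix.mulVec, Finset.mul_sum, covariance_const_mul_left,
    covariance_const_mul_right, hC]
  refine Finset.sum_congr rfl fun i _ => Finset.sum_congr rfl fun j _ => ?_
  ring

lemma toEuclideanCLM_jacobianMatrix (T : EuclideanSpace ℝ (Fin d) → EuclideanSpace ℝ (Fin d))
    (x : EuclideanSpace ℝ (Fin d)) :
    Matrix.toEuclideanCLM (𝕜 := ℝ) (jacobianMatrix T x) = fderiv ℝ T x := by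
  ext v i
  have hv : v = ∑ j, v j • EuclideanSpace.single j (1 : ℝ) := by
    ext k
    simp [Pi.single_apply]
  conv_rhs => rw [hv]
  simp only [Matrix.ofLp_toEuclideanCLM, Matrix.mulVec, dotProduct, jacobianMatrix,
    Matrix.of_apply, map_sum, map_smul]
  simp [mul_comm]

end LimitEquation

/-! ### The main theorem -/

theorem theorem3 {d : ℕ} {Ω : Type*} [MeasurableSpace Ω] (P : Measure Ω) [IsProbabilityMeasure P]
    -- the noise is i.i.d. with mean zero and positive definite covariance matrix `C`
    (w : ℕ → Ω → EuclideanSpace ℝ (Fin d))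
    (hw_meas : ∀ k, Measurable (w k))
    (hw_indep : iIndepFun w P)
    (hw_ident : ∀ k, IdentDistrib (w k) (w 0) P P)
    (hw_sq : MemLp (w 0) 2 P)
    (hw_mean : ∫ ω, w 0 ω ∂P = 0)
    (C : Matrix (Fin d) (Fin d) ℝ)
    (hC : ∀ i j, C i j = cov[fun ω => w 0 ω i, fun ω => w 0 ω j; P])
    (hC_pos : C.PosDef)
    -- `T` is differentiable and a contraction in a weighted `ℓ²` norm, with fixed point `xs`
    (T : EuclideanSpace ℝ (Fin d) → EuclideanSpace ℝ (Fin d))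
    (hT_diff : Differentiable ℝ T)
    (μ : Fin d → ℝ) (hμ : ∀ i, 0 < μ i)
    (γ : ℝ) (hγ_pos : 0 < γ) (hγ_lt : γ < 1)
    (hT_contr : ∀ x₁ x₂, weightedNorm μ (T x₁ - T x₂) ≤ γ * weightedNorm μ (x₁ - x₂))
    (xs : EuclideanSpace ℝ (Fin d)) (hxs : T xs = xs) :
    -- `π α` is the law of the limit `Y^(α)`
    ∃ αbar : ℝ, 0 < αbar ∧ ∃ π : ℝ → ProbabilityMeasure (EuclideanSpace ℝ (Fin d)),
      (∀ α ∈ Set.Ioo 0 αbar,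
        (∀ x₀ : EuclideanSpace ℝ (Fin d),
          TendstoInDistribution (fun k => scaledIterate T xs w x₀ α k) atTop
            (id : EuclideanSpace ℝ (Fin d) → EuclideanSpace ℝ (Fin d)) (fun _ => P)
            (π α : Measure (EuclideanSpace ℝ (Fin d)))) ∧
        IsStationaryLaw T xs α (P.map (w 0)) (π α) ∧
        Integrable (fun y => ‖y‖ ^ 2) (π α : Measure (EuclideanSpace ℝ (Fin d)))) ∧
      -- `πY` is the law of the limit `Y`
      ∃ πY : ProbabilityMeasure (EuclideanSpace ℝ (Fin d)),
        (∀ a : ℕ → ℝ, (∀ i, a i ∈ Set.Ioo 0 αbar) → Tendsto a atTop (𝓝 0) →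
          Tendsto (fun i => π (a i)) atTop (𝓝 πY)) ∧
        SolvesLimitEquation C (jacobianMatrix T xs - 1) πY ∧
        ∃ SY : Matrix (Fin d) (Fin d) ℝ,
          SY.PosDef ∧
          SolvesLyapunov (jacobianMatrix T xs - 1) C SY ∧
          (∀ S', SolvesLyapunov (jacobianMatrix T xs - 1) C S' → S' = SY) ∧
          ((∃! ρ : ProbabilityMeasure (EuclideanSpace ℝ (Fin d)),
              SolvesLimitEquation C (jacobianMatrix T xs - 1) ρ) →
            (πY : Measure (EuclideanSpace ℝ (Fin d))) = multivariateGaussian 0 SY) := by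
  let D := weightScale μ hμ
  let ν := P.map (w 0)
  have hw0 := (hw_meas 0).aemeasurable (μ := P)
  have : IsProbabilityMeasure ν := Measure.isProbabilityMeasure_map hw0
  have hν : MemLp (fun v => v) 2 ν := (memLp_map_measure_iff aestronglyMeasurable_id hw0).2 hw_sq
  have hν0 : ∫ v, v ∂ν = 0 := by
    rw [← hw_mean]
    exact integral_map hw0 aestronglyMeasurable_id
  have hT : ∀ x y, ‖D (T x - T y)‖ ≤ γ * ‖D (x - y)‖ := fun x y => by
    simpa only [weightedNorm_eq (hμ := hμ)] using hT_contr x y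
  have hTc : Continuous T := hT_diff.continuous
  have hV : 0 ≤ ∫ v, ‖D v‖ ^ 2 ∂ν := integral_nonneg fun _ => by positivity
  -- This moment bound works for every `α < 1`: with `ρ = 1 - α * (1 - γ)` the invariance condition
  -- becomes `(ρ ^ 2 + 1 - ρ) * K ≤ K`, true because `0 ≤ ρ ≤ 1`.
  set K := (∫ v, ‖D v‖ ^ 2 ∂ν) / (1 - γ) with hK
  have h1γ : 0 < 1 - γ := sub_pos.2 hγ_lt
  have hK0 : 0 ≤ K := by positivity
  have hstat : ∀ α ∈ Set.Ioo (0 : ℝ) 1, ∃ π : ProbabilityMeasure (EuclideanSpace ℝ (Fin d)),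
      (∀ (x : EuclideanSpace ℝ (Fin d)) (m : ℕ → ProbabilityMeasure (EuclideanSpace ℝ (Fin d))),
        (∀ k, (m k : Measure (EuclideanSpace ℝ (Fin d))) = (stepLaw (driftStep T xs α) √α ν)^[k] (Measure.dirac x)) →
        Tendsto m atTop (𝓝 π)) ∧
      stepLaw (driftStep T xs α) √α ν π = π ∧
      ∫⁻ y, ENNReal.ofReal (‖D y‖ ^ 2) ∂(π : Measure (EuclideanSpace ℝ (Fin d))) ≤ ENNReal.ofReal K := by
    rintro α ⟨hα0, hα1⟩
    have hp := mul_pos hα0 h1γ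
    have hρ0 : 0 ≤ 1 - α * (1 - γ) := by nlinarith
    refine exists_stationary_law (norm_map_driftStep_sub_le hT xs hα0.le hα1.le) hρ0
      (by linarith) (by simp [driftStep, hxs]) _ ν hν hν0 hK0 ?_
    have h1 : (∫ v, ‖D v‖ ^ 2 ∂ν) = (1 - γ) * K := by rw [hK]; field_simp
    rw [Real.sq_sqrt hα0.le, h1]
    nlinarith [mul_nonneg hK0 (mul_nonneg hρ0 hp.le)]
  choose! π hconv hπ hπK using hstat
  have hdom : ∀ y : EuclideanSpace ℝ (Fin d), ‖y‖ ^ 2 ≤ ‖D.symm.toContinuousLinearMap‖ ^ 2 * ‖D y‖ ^ 2 := fun y => by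
    rw [← mul_pow]
    have := D.symm.toContinuousLinearMap.le_opNorm (D y)
    gcongr
    simpa using this
  have hintD : ∀ α ∈ Set.Ioo (0 : ℝ) 1, Integrable (fun y => ‖D y‖ ^ 2) (π α : Measure (EuclideanSpace ℝ (Fin d))) ∧
      ∫ y, ‖D y‖ ^ 2 ∂(π α : Measure (EuclideanSpace ℝ (Fin d))) ≤ K := by
    intro α hα
    have hc : Continuous fun y => ‖D y‖ ^ 2 := by fun_prop
    have h1 : Integrable (fun y => ‖D y‖ ^ 2) (π α : Measure (EuclideanSpace ℝ (Fin d))) :=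
      (lintegral_ofReal_ne_top_iff_integrable hc.aestronglyMeasurable
        (.of_forall fun _ => by positivity)).1 ((hπK α hα).trans_lt ENNReal.ofReal_lt_top).ne
    refine ⟨h1, ?_⟩
    have h2 := hπK α hα
    rwa [← ofReal_integral_eq_lintegral_ofReal h1 (.of_forall fun _ => by positivity),
      ENNReal.ofReal_le_ofReal_iff hK0] at h2
  have hint : ∀ α ∈ Set.Ioo (0 : ℝ) 1, Integrable (fun y => ‖y‖ ^ 2) (π α : Measure (EuclideanSpace ℝ (Fin d))) :=
    fun α hα => ((hintD α hα).1.const_mul _).mono' (by fun_prop) (.of_forall fun y => by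
      rw [Real.norm_eq_abs, abs_of_nonneg (by positivity)]
      exact hdom y)
  have hintK : ∀ α ∈ Set.Ioo (0 : ℝ) 1, ∫ y, ‖y‖ ^ 2 ∂(π α : Measure (EuclideanSpace ℝ (Fin d))) ≤
      ‖D.symm.toContinuousLinearMap‖ ^ 2 * K := fun α hα => by
    refine (integral_mono (hint α hα) ((hintD α hα).1.const_mul _) hdom).trans ?_
    rw [integral_const_mul]
    have := (hintD α hα).2
    gcongr
  -- the linearization and the limiting covariance
  have hD : ∀ x y, inner ℝ (D x) y = inner ℝ x (D y) := inner_weightScale_left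
  have hTL : HasFDerivAt T (Matrix.toEuclideanCLM (𝕜 := ℝ) (jacobianMatrix T xs)) xs := by
    rw [toEuclideanCLM_jacobianMatrix]
    exact (hT_diff xs).hasFDerivAt
  set J := jacobianMatrix T xs
  have hJ := norm_map_fderiv_le hTL hT
  obtain ⟨S, hSpos, hS, huniq⟩ := exists_solvesLyapunov hD hγ_pos.le hγ_lt hJ hC_pos
  have hQ0 : ∀ x : EuclideanSpace ℝ (Fin d), 0 ≤ inner ℝ x (Matrix.toEuclideanCLM (𝕜 := ℝ) S x) := fun x => by
    rw [Matrix.inner_toEuclideanCLM]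
    simpa using hSpos.posSemidef.dotProduct_mulVec_nonneg x.ofLp
  have hTlip : ∀ y, ‖T y - T xs‖ ≤
      ‖D.symm.toContinuousLinearMap‖ * γ * ‖D.toContinuousLinearMap‖ * ‖y - xs‖ := fun y => by
    calc ‖T y - T xs‖ = ‖D.symm.toContinuousLinearMap (D (T y - T xs))‖ := by simp
      _ ≤ ‖D.symm.toContinuousLinearMap‖ * (γ * (‖D.toContinuousLinearMap‖ * ‖y - xs‖)) := by
          refine (D.symm.toContinuousLinearMap.le_opNorm _).trans ?_
          gcongr
          refine (hT y xs).trans ?_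
          gcongr
          exact D.toContinuousLinearMap.le_opNorm _
      _ = _ := by ring
  have hσ : ∀ t : EuclideanSpace ℝ (Fin d), ∫ v, inner ℝ v t ^ 2 ∂ν =
      inner ℝ t (Matrix.toEuclideanCLM (𝕜 := ℝ) C t) := fun t => by
    rw [← integral_inner_sq_eq P hw_sq hw_mean hC]
    exact integral_map hw0 (Continuous.aestronglyMeasurable (by fun_prop))
  set L := Matrix.toEuclideanCLM (𝕜 := ℝ) J
  have hlim := tendsto_charFun_stationary hTc hxs hTL hTlip hγ_pos.le hγ_lt
    (norm_symm_adjoint_le hD hJ) ν hν hν0 π hπ hint hintK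
    (Q := fun t => inner ℝ t (Matrix.toEuclideanCLM (𝕜 := ℝ) S t))
    (q := fun t => inner ℝ (ContinuousLinearMap.adjoint L t - t)
      (Matrix.toEuclideanCLM (𝕜 := ℝ) S (ContinuousLinearMap.adjoint L t - t)))
    (by fun_prop) (by simp) hQ0 (fun t => hQ0 _)
    (C := ‖Matrix.toEuclideanCLM (𝕜 := ℝ) S‖ * (‖ContinuousLinearMap.adjoint L‖ + 1) ^ 2)
    (by positivity) (fun t => by
      have h1 : ‖ContinuousLinearMap.adjoint L t - t‖ ≤
          (‖ContinuousLinearMap.adjoint L‖ + 1) * ‖t‖ := by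
        refine (norm_sub_le _ _).trans ?_
        have := (ContinuousLinearMap.adjoint L).le_opNorm t
        linarith
      set z := ContinuousLinearMap.adjoint L t - t
      calc inner ℝ z (Matrix.toEuclideanCLM (𝕜 := ℝ) S z)
          ≤ ‖z‖ * ‖Matrix.toEuclideanCLM (𝕜 := ℝ) S z‖ := real_inner_le_norm _ _
        _ ≤ ‖z‖ * (‖Matrix.toEuclideanCLM (𝕜 := ℝ) S‖ * ‖z‖) := by
            gcongr
            exact ContinuousLinearMap.le_opNorm _ _
        _ = ‖Matrix.toEuclideanCLM (𝕜 := ℝ) S‖ * ‖z‖ ^ 2 := by ring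
        _ ≤ ‖Matrix.toEuclideanCLM (𝕜 := ℝ) S‖ *
            ((‖ContinuousLinearMap.adjoint L‖ + 1) * ‖t‖) ^ 2 := by gcongr
        _ = _ := by ring)
    (fun α t => by rw [hσ]; exact inner_adjointStep hS α t)
  have hchar : ∀ t : EuclideanSpace ℝ (Fin d), charFun (multivariateGaussian 0 S) t =
      (Real.exp (-(inner ℝ t (Matrix.toEuclideanCLM (𝕜 := ℝ) S t)) / 2) : ℂ) := fun t => by
    rw [charFun_multivariateGaussian hSpos.posSemidef, Matrix.inner_toEuclideanCLM]
    push_cast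
    congr 1
    simp
    ring
  -- The threshold is `1`, where the drift ceases to be visibly a contraction. The limit law is
  -- taken to be the Gaussian itself, so its identification is definitional.
  refine ⟨1, one_pos, π, fun α hα => ⟨fun x₀ => ?_, hπ α hα, hint α hα⟩,
    ⟨multivariateGaussian 0 S, inferInstance⟩, fun a ha ha0 => ?_, ?_, S, hSpos, hS, huniq,
    fun _ => rfl⟩
  · have hmap := map_scaledIterate hw_meas hw_indep hw_ident hTc xs x₀ hα.1
    refine ⟨fun k => (hmap k).1.aemeasurable, aemeasurable_id, ?_⟩
    have h1 := hconv α hα _ (fun k => ⟨P.map (scaledIterate T xs w x₀ α k),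
      Measure.isProbabilityMeasure_map (hmap k).1.aemeasurable⟩) fun k => (hmap k).2
    have h2 : (⟨(π α : Measure (EuclideanSpace ℝ (Fin d))).map id,
        Measure.isProbabilityMeasure_map aemeasurable_id⟩ :
        ProbabilityMeasure (EuclideanSpace ℝ (Fin d))) = π α := Subtype.ext Measure.map_id
    rw [h2]
    exact h1
  · refine ProbabilityMeasure.tendsto_of_tendsto_charFun fun t => ?_
    have h1 : Tendsto a atTop (𝓝[>] 0) :=
      tendsto_nhdsWithin_iff.2 ⟨ha0, .of_forall fun i => (ha i).1⟩
    have h2 := (hlim t).comp h1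
    rw [← hchar] at h2
    exact h2
  · exact solvesLimitEquation_of_charFun hS (multivariateGaussian 0 S) IsGaussian.integrable_id hchar
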